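/- **Theorem 3.6.** Let $\mathbb{K}$ be an algebraically closed field of characteristic zero, let $d\ge 3$ and $1\le a<b\le d-1$ be integers with $\mathrm{GCD}(a,b,d)=1$, let $e\in\mathbb{K}$ be a primitive $d$-th root of unity, and let $M_{a,b}=\mathrm{diag}(1,e^a,e^b)$ act on $R=\mathbb{K}[x,y,z]$ by linear substitution of the variables. Let $I=I^d_{0,a,b}\subset R$ be the ideal generated by all monomials of degree $d$ that are invariant under $M_{a,b}$. Then $I$ is a minimal GT-system, that is, $I$ is a GT-system and a minimal monomial Togliatti system. Here the following terminology is used for an ideal $J$ of $R$. * $J$ is a *Togliatti system* (of degree $d$) if $R/J$ is artinian, $J$ can be generated by at most $d+1$ forms of degree $d$, and $J$ fails the Weak Lefschetz Property in degree $d-1$, i.e. for every linear form $L\in R$ the multiplication map $\times L\colon [R/J]_{d-1}\to[R/J]_d$ is neither injective nor surjective. * A *monomial Togliatti system* is a Togliatti system that can be generated by monomials. It is *minimal* if no proper subset of the set of its monomial generators of degree $d$ generates a monomial Togliatti system. * A Togliatti system $J$ is a *GT-system* if the regular map $\varphi_J=(F_1:\dots:F_r)\colon\mathbb{P}^2\to\mathbb{P}^{r-1}$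 given by a basis $F_1,\dots,F_r$ of the space of forms of degree $d$ in $J$ is a Galois covering of its image of degree $d$ with Galois group $\mathbb{Z}/d\mathbb{Z}$, i.e. the function field of $\mathbb{P}^2$ is a Galois extension of degree $d$ of the function field of $\varphi_J(\mathbb{P}^2)$ with Galois group isomorphic to $\mathbb{Z}/d\mathbb{Z}$. -/

import Mathlib

namespace Togliatti

open MvPolynomial

/-- The degree `j` component `[R/I]_j` of `R/I`, where `R = K[x_0,…,x_n]`. -/
noncomputable def gradedPiece {K : Type*} [Field K] {n : ℕ} (I : Ideal (MvPolynomial (Fin (n + 1)) K)) (j : ℕ) :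
    Submodule K (MvPolynomial (Fin (n + 1)) K ⧸ I) :=
  (homogeneousSubmodule (Fin (n + 1)) K j).map (Ideal.Quotient.mkₐ K I).toLinearMap

/-- The multiplication map `× L : [R/I]_j → [R/I]_{j+1}` has maximal rank, i.e. it is injective or
surjective. -/
def HasMaximalRank {K : Type*} [Field K] {n : ℕ} (I : Ideal (MvPolynomial (Fin (n + 1)) K))
    (L : MvPolynomial (Fin (n + 1)) K) (j : ℕ) : Prop :=
  Set.InjOn (fun q => Ideal.Quotient.mk I L * q) (gradedPiece I j : Set _) ∨
    Set.SurjOn (fun q => Ideal.Quotient.mk I L * q) (gradedPiece I j : Set _)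
      (gradedPiece I (j + 1) : Set _)

/-- `I` fails the Weak Lefschetz Property in degree `j`: for no linear form `L` does
`× L : [R/I]_j → [R/I]_{j+1}` have maximal rank. (Maximal rank is an open condition on `L`, so this
is the same as failure for a general `L`.) -/
def FailsWLPInDegree {K : Type*} [Field K] {n : ℕ} (I : Ideal (MvPolynomial (Fin (n + 1)) K))
    (j : ℕ) : Prop :=
  ∀ L : MvPolynomial (Fin (n + 1)) K, L.IsHomogeneous 1 → ¬ HasMaximalRank I L j

/-- Togliatti system of forms of degree `d` in `K[x_0,…,x_n]` (for `n, d ≥ 1`): an artinian ideal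
generated by `r ≤ binom(n+d-1, n-1)` forms of degree `d` that fails the WLP in degree `d-1`. -/
structure IsTogliattiSystem {K : Type*} [Field K] {n : ℕ} (d : ℕ)
    (I : Ideal (MvPolynomial (Fin (n + 1)) K)) : Prop where
  artinian : IsArtinianRing (MvPolynomial (Fin (n + 1)) K ⧸ I)
  generators : ∃ S : Finset (MvPolynomial (Fin (n + 1)) K),
    (∀ F ∈ S, F.IsHomogeneous d) ∧ S.card ≤ (n + d - 1).choose (n - 1) ∧
      Ideal.span (S : Set (MvPolynomial (Fin (n + 1)) K)) = I
  failsWLP : FailsWLPInDegree I (d - 1)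

/-- A Togliatti system that can be generated by monomials. -/
structure IsMonomialTogliattiSystem {K : Type*} [Field K] {n : ℕ} (d : ℕ)
    (I : Ideal (MvPolynomial (Fin (n + 1)) K)) : Prop extends IsTogliattiSystem d I where
  monomial : ∃ S : Set (Fin (n + 1) →₀ ℕ),
    I = Ideal.span ((fun s => MvPolynomial.monomial s (1 : K)) '' S)

/-- The monomials of degree `d` that lie in `I`; if `I` is generated by monomials of degree `d`,
this is its unique minimal set of monomial generators. -/
def monomialGenerators {K : Type*} [Field K] {n : ℕ} (d : ℕ)
    (I : Ideal (MvPolynomial (Fin (n + 1)) K)) : Set (MvPolynomial (Fin (n + 1)) K) :=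
  {m | m ∈ I ∧ ∃ s : Fin (n + 1) →₀ ℕ, s.degree = d ∧ m = MvPolynomial.monomial s 1}

/-- A monomial Togliatti system is minimal if no proper subset of its set of monomial generators
generates a monomial Togliatti system. -/
structure IsMinimalTogliattiSystem {K : Type*} [Field K] {n : ℕ} (d : ℕ)
    (I : Ideal (MvPolynomial (Fin (n + 1)) K)) : Prop extends IsMonomialTogliattiSystem d I where
  minimal : ∀ S : Set (MvPolynomial (Fin (n + 1)) K), S ⊂ monomialGenerators d I →
    ¬ IsMonomialTogliattiSystem d (Ideal.span S)

/-- The function field of `ℙⁿ`: quotients of forms of equal degree, inside `K(x_0,…,x_n)`. -/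
noncomputable def projectiveFunctionField (K : Type*) [Field K] (n : ℕ) :
    IntermediateField K (FractionRing (MvPolynomial (Fin (n + 1)) K)) :=
  IntermediateField.adjoin K
    {q | ∃ (j : ℕ) (F G : MvPolynomial (Fin (n + 1)) K), F.IsHomogeneous j ∧ G.IsHomogeneous j ∧
      G ≠ 0 ∧ q = algebraMap _ (FractionRing (MvPolynomial (Fin (n + 1)) K)) F /
        algebraMap _ (FractionRing (MvPolynomial (Fin (n + 1)) K)) G}

/-- The function field of the image of the map `φ_I = (F_1 : … : F_r)` on `ℙⁿ`, where
`F_1,…,F_r` span the space `I_d` of forms of degree `d` in `I`, as a subfield of the function field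
of `ℙⁿ`: it is generated over `K` by the quotients of elements of `I_d`. -/
noncomputable def imageFunctionField {K : Type*} [Field K] {n : ℕ} (d : ℕ)
    (I : Ideal (MvPolynomial (Fin (n + 1)) K)) :
    IntermediateField K (FractionRing (MvPolynomial (Fin (n + 1)) K)) :=
  IntermediateField.adjoin K
    {q | ∃ F G : MvPolynomial (Fin (n + 1)) K, F ∈ I ∧ G ∈ I ∧ F.IsHomogeneous d ∧
      G.IsHomogeneous d ∧ G ≠ 0 ∧
      q = algebraMap _ (FractionRing (MvPolynomial (Fin (n + 1)) K)) F /
        algebraMap _ (FractionRing (MvPolynomial (Fin (n + 1)) K)) G}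

theorem imageFunctionField_le {K : Type*} [Field K] {n : ℕ} (d : ℕ)
    (I : Ideal (MvPolynomial (Fin (n + 1)) K)) :
    imageFunctionField d I ≤ projectiveFunctionField K n := by
  refine IntermediateField.adjoin.mono K _ _ ?_
  rintro q ⟨F, G, -, -, hF, hG, h0, rfl⟩
  exact ⟨d, F, G, hF, hG, h0, rfl⟩

/-- The function field of `ℙⁿ` as an extension of the function field of the image of `φ_I`. -/
noncomputable abbrev coveringExtension {K : Type*} [Field K] {n : ℕ} (d : ℕ)
    (I : Ideal (MvPolynomial (Fin (n + 1)) K)) :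
    IntermediateField (imageFunctionField d I) (FractionRing (MvPolynomial (Fin (n + 1)) K)) :=
  IntermediateField.extendScalars (imageFunctionField_le d I)

/-- `φ_I`, as a covering of its image, is Galois of degree `d` with Galois group `ℤ/dℤ`. For an
artinian ideal generated by forms of degree `d`, `φ_I` is a finite regular map, and it is a Galois
covering when the extension of function fields is Galois. -/
structure IsCyclicGaloisCovering {K : Type*} [Field K] {n : ℕ} (d : ℕ)
    (I : Ideal (MvPolynomial (Fin (n + 1)) K)) : Prop where
  galois : IsGalois (imageFunctionField d I) (coveringExtension d I)
  degree : Module.finrank (imageFunctionField d I) (coveringExtension d I) = d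
  group : Nonempty ((coveringExtension d I ≃ₐ[imageFunctionField d I] coveringExtension d I) ≃*
    Multiplicative (ZMod d))

/-- GT-system (Galois-Togliatti system): a Togliatti system such that `φ_I` is a Galois covering of
degree `d` with cyclic Galois group `ℤ/dℤ`. -/
structure IsGTSystem {K : Type*} [Field K] {n : ℕ} (d : ℕ)
    (I : Ideal (MvPolynomial (Fin (n + 1)) K)) : Prop extends IsTogliattiSystem d I where
  covering : IsCyclicGaloisCovering d I

/-- The action of a matrix on polynomials by linear substitution of the variables. -/
noncomputable def matrixAction {K : Type*} [Field K] {n : ℕ}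
    (M : Matrix (Fin (n + 1)) (Fin (n + 1)) K) :
    MvPolynomial (Fin (n + 1)) K →ₐ[K] MvPolynomial (Fin (n + 1)) K :=
  aeval fun i => ∑ j, C (M i j) * X j

/-- The ideal generated by all monomials of degree `d` that are invariant under `M`. -/
noncomputable def invariantMonomialIdeal {K : Type*} [Field K] {n : ℕ} (d : ℕ)
    (M : Matrix (Fin (n + 1)) (Fin (n + 1)) K) : Ideal (MvPolynomial (Fin (n + 1)) K) :=
  Ideal.span {m | ∃ s : Fin (n + 1) →₀ ℕ, s.degree = d ∧ m = MvPolynomial.monomial s 1 ∧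
    matrixAction M m = m}

/-- `M_{a,b} = diag(1, e^a, e^b)`. -/
def diagMatrix {K : Type*} [Field K] (e : K) (a b : ℕ) : Matrix (Fin 3) (Fin 3) K :=
  Matrix.diagonal ![1, e ^ a, e ^ b]

end Togliatti

/-! Everything rests on the norm `N(L)`, the product of the `d` conjugates of a linear form `L`
under `diag(1, e^a, e^b)`. It is an invariant form of degree `d`, so it lies in `I` while its
cofactor of degree `d - 1` does not: `× L` is not injective. There are at most `d + 1` invariant
monomials, and `dim R_d = dim R_{d-1} + (d + 1)`, so a nonzero kernel also rules out surjectivity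
(`failsWLPInDegree_invariant`, `card_invariantExponents_le`).

For minimality, take `L = x + y + z`. If a proper subset of the monomials generated a Togliatti
system, some nonzero multiple of `L` of degree `d` would lie in its span. This multiple is
invariant, hence divisible by all `d` conjugates of `L`. They are pairwise non-associate primes, so
it is a scalar times `N(L)`. But every invariant monomial occurs in `N(L)`
(`coeff_prod_linearFactor_ne_zero`), a contradiction.

That last fact is the hard point. `N(L)` is the determinant of the circulant matrix `x I + y P_a + z
P_b`, whose Leibniz expansion runs over permutations of `ℤ/d` with all steps in `{0, a, b}`. An
interval exchange realizes each invariant monomial (`exists_perm_card_steps`). Terms with the same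
monomial do not cancel, because they have the same sign (`sign_eq_of_card_steps_eq`): orbits lift to
lattice paths in the plane, disjoint paths must have equal slope, and this forces all nontrivial
cycles to have one length, determined by the step counts.

The covering is a Kummer extension: with `p a + q b ≡ 1` mod `d`, the function `w = (y/x)^p (z/x)^q`
is multiplied by `e`, its `d`-th power is invariant, and it generates the function field of the
plane over that of the image. -/

namespace Togliatti

/-! ### Orbits as lattice paths, and signs of permutations with few steps -/

section LatticePaths

open Equiv Finset

/-- A discrete intermediate value theorem. -/
theorem exists_eq_zero_of_step_le {F : ℕ → ℤ} (h0 : F 0 ≤ 0) (hs : ∀ m, F (m + 1) ≤ F m + 1)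
    {M : ℕ} (hM : 0 ≤ F M) : ∃ m, F m = 0 := by
  induction M with
  | zero => exact ⟨0, le_antisymm h0 hM⟩
  | succ M ih =>
    by_cases h : 0 ≤ F M
    · exact ih h
    · exact ⟨M + 1, by have := hs M; omega⟩

theorem apply_pow_ne {G : Type*} (π : Perm G) {s : G} (hs : π s ≠ s) (m : ℕ) :
    π ((π ^ m) s) ≠ (π ^ m) s := by
  rw [← Perm.mul_apply, ← pow_succ', pow_succ, Perm.mul_apply]
  exact fun h => hs ((π ^ m).injective h)

/-- Turns cycle lengths into periods of points, so that cycle types can be compared orbit by orbit.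
-/
theorem exists_period_of_mem_cycleType {G : Type*} [DecidableEq G] [Fintype G]
    {π : Perm G} {r : ℕ} (hr : r ∈ π.cycleType) :
    ∃ s, π s ≠ s ∧ ∀ n, (π ^ n) s = s ↔ r ∣ n := by
  rw [Perm.cycleType_def, Multiset.mem_map] at hr
  obtain ⟨c, hc, rfl⟩ := hr
  have hc' : c ∈ π.cycleFactorsFinset := hc
  obtain ⟨hcyc, hcs⟩ := Perm.mem_cycleFactorsFinset_iff.1 hc'
  obtain ⟨s, hs⟩ := hcyc.nonempty_support
  have hpow (n : ℕ) : (π ^ n) s = (c ^ n) s := by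
    induction n with
    | zero => rfl
    | succ n ih =>
      rw [pow_succ', pow_succ', Perm.mul_apply, Perm.mul_apply, ih]
      exact (hcs _ (Perm.pow_apply_mem_support.2 hs)).symm
  refine ⟨s, by rw [← hcs s hs]; exact Perm.mem_support.1 hs, fun n => ?_⟩
  rw [hpow, Function.comp_apply, ← hcyc.orderOf, orderOf_dvd_iff_pow_eq_one, hcyc.pow_eq_one_iff]
  exact ⟨fun h => ⟨s, Perm.mem_support.1 hs, h⟩, fun h => by
    rw [hcyc.pow_eq_one_iff.2 h]; rfl⟩

variable {G : Type*} [AddCommGroup G] [DecidableEq G]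

/-- The number of steps `α` among the first `m` steps of the orbit of `s` under `π`. -/
def stepCount (π : Perm G) (α s : G) (m : ℕ) : ℕ :=
  #{i ∈ range m | π ((π ^ i) s) = (π ^ i) s + α}

theorem stepCount_zero (π : Perm G) (α s : G) : stepCount π α s 0 = 0 := by simp [stepCount]

theorem stepCount_succ (π : Perm G) (α s : G) (m : ℕ) :
    stepCount π α s (m + 1) =
      stepCount π α s m + if π ((π ^ m) s) = (π ^ m) s + α then 1 else 0 := by
  unfold stepCount
  rw [range_add_one, filter_insert]
  split_ifs with h
  · rw [card_insert_of_notMem (by simp)]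
  · rfl

theorem stepCount_add (π : Perm G) (α s : G) (m n : ℕ) :
    stepCount π α s (m + n) = stepCount π α s m + stepCount π α ((π ^ m) s) n := by
  induction n with
  | zero => simp [stepCount_zero]
  | succ n ih =>
    rw [← add_assoc, stepCount_succ, ih, stepCount_succ, ← Perm.mul_apply (π ^ n), ← pow_add,
      add_comm n m, add_assoc]

theorem stepCount_le (π : Perm G) (α s : G) (m : ℕ) : stepCount π α s m ≤ m :=
  (card_filter_le _ _).trans (card_range m).le

theorem stepCount_mul (π : Perm G) (α s : G) {n : ℕ} (h : (π ^ n) s = s) (m : ℕ) :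
    stepCount π α s (m * n) = m * stepCount π α s n := by
  induction m with
  | zero => simp [stepCount_zero]
  | succ m ih =>
    rw [Nat.succ_mul, add_comm, stepCount_add, h, ih, Nat.succ_mul, add_comm]

theorem stepCount_pow_apply (π : Perm G) (α s : G) {n : ℕ} (h : (π ^ n) s = s) (m : ℕ) :
    stepCount π α ((π ^ m) s) n = stepCount π α s n := by
  have h1 := stepCount_add π α s m n
  have h2 := stepCount_add π α s n m
  rw [h, add_comm n m] at h2
  omega

variable {π : Perm G} {α β : G}

/-- Lifts the orbit of a moved point to a path in `ℤ²`: none of its steps is zero, so the non-`α`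
steps are all `β`. -/
theorem pow_apply_eq_add (hπ : ∀ t, π t = t ∨ π t = t + α ∨ π t = t + β) {s : G} (hs : π s ≠ s)
    (m : ℕ) : (π ^ m) s =
      s + ((stepCount π α s m : ℤ) • α + ((m : ℤ) - stepCount π α s m) • β) := by
  induction m with
  | zero => simp [stepCount_zero]
  | succ m ih =>
    rw [pow_succ', Perm.mul_apply, stepCount_succ]
    split_ifs with h
    · rw [h, ih]; push_cast; module
    · rw [((hπ _).resolve_left (apply_pow_ne π hs m)).resolve_left h, ih]; push_cast; module

/-- Two lifted paths of different slope would meet, and then the orbits coincide and have the same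
count. Exchanging `s` and `s'` gives equality. -/
theorem stepCount_orderOf_le (hπ : ∀ t, π t = t ∨ π t = t + α ∨ π t = t + β)
    (hgen : ∀ g : G, ∃ u w : ℕ, w ≤ u ∧ g = u • α - w • β) {s s' : G} (hs : π s ≠ s)
    (hs' : π s' ≠ s') :
    stepCount π α s (orderOf π) ≤ stepCount π α s' (orderOf π) := by
  by_contra! hlt
  obtain ⟨u, w, hwu, hg⟩ := hgen (s' - s)
  set D := orderOf π
  have hD (t : G) : (π ^ D) t = t := by simp [D, pow_orderOf_eq_one]
  obtain ⟨r, rfl⟩ := Nat.exists_eq_add_of_le hwu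
  -- The lifts start at `(0, 0)` and `(w + r, -w)`; a head start of `r` steps puts them on the same
  -- antidiagonal. The function is the difference of their `α`-coordinates, and a zero is a meeting
  -- point. A surplus of one `α`-step per `D` steps makes up the deficit `w + r` within `(w + r) *
  -- D` steps.
  obtain ⟨m, hm⟩ := exists_eq_zero_of_step_le
    (F := fun m => (stepCount π α s (r + m) : ℤ) - (w + r : ℕ) - stepCount π α s' m)
    (by have := stepCount_le π α s r; simp [stepCount_zero]; omega)
    (fun m => by
      rw [← add_assoc, stepCount_succ, stepCount_succ]; split_ifs <;> push_cast <;> omega)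
    (M := (w + r) * D) (by
      have h1 : stepCount π α s ((w + r) * D) ≤ stepCount π α s (r + (w + r) * D) := by
        rw [add_comm r, stepCount_add]; omega
      rw [stepCount_mul π α s (hD s)] at h1
      rw [stepCount_mul π α s' (hD s')]
      have h2 : (w + r) * (stepCount π α s' D + 1) ≤ (w + r) * stepCount π α s D := by gcongr; omega
      push_cast
      zify at h1 h2
      linarith)
  have hmeet : (π ^ (r + m)) s = (π ^ m) s' := by
    have hg' : s' = (w + r) • α - w • β + s := by rw [← hg, sub_add_cancel]
    rw [pow_apply_eq_add hπ hs, pow_apply_eq_add hπ hs']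
    have h1 : (stepCount π α s (r + m) : ℤ) = (w + r : ℕ) + stepCount π α s' m := by linarith
    rw [h1]
    generalize stepCount π α s' m = c
    rw [hg']
    push_cast; module
  have h1 := stepCount_pow_apply π α s (hD s) (r + m)
  have h2 := stepCount_pow_apply π α s' (hD s') m
  rw [hmeet] at h1
  omega

variable [Fintype G]

theorem sum_stepCount (π : Perm G) (hα : α ≠ 0) (n : ℕ) :
    ∑ s ∈ π.support, stepCount π α s n = n * #{t | π t = t + α} := by
  induction n with
  | zero => simp [stepCount_zero]
  | succ n ih =>
    simp_rw [stepCount_succ, sum_add_distrib, ih, Nat.succ_mul]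
    congr 1
    rw [← sum_filter, sum_const, smul_eq_mul, mul_one]
    refine card_bij (fun s _ => (π ^ n) s) (by simp) (fun _ _ _ _ h => (π ^ n).injective h) ?_
    intro t ht
    obtain ⟨s, rfl⟩ := (π ^ n).surjective t
    refine ⟨s, ?_, rfl⟩
    have ht' := (mem_filter.1 ht).2
    simp only [mem_filter, Perm.mem_support]
    refine ⟨fun h => ?_, ht'⟩
    have : (π ^ n) s = s := Perm.pow_apply_eq_self_of_apply_eq_self h n
    rw [this, h] at ht'
    exact hα (by simpa using ht')

/-- All moved points have the same `α`-count over `orderOf π` steps, so each count equals the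
average over the support: every closed orbit has the global slope. -/
theorem stepCount_mul_card_support (hπ : ∀ t, π t = t ∨ π t = t + α ∨ π t = t + β) (hα : α ≠ 0)
    (hgen : ∀ g : G, ∃ u w : ℕ, w ≤ u ∧ g = u • α - w • β) {s : G} (hs : π s ≠ s)
    {n : ℕ} (hn : (π ^ n) s = s) :
    stepCount π α s n * #π.support = n * #{t | π t = t + α} := by
  set D := orderOf π
  have hD (t : G) : (π ^ D) t = t := by simp [D, pow_orderOf_eq_one]
  have hD0 : 0 < D := orderOf_pos π
  have h1 : #π.support * stepCount π α s D = D * #{t | π t = t + α} := by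
    rw [← sum_stepCount π hα D, ← smul_eq_mul, ← sum_const]
    refine sum_congr rfl fun t ht => le_antisymm ?_ ?_
    · exact stepCount_orderOf_le hπ hgen hs (Perm.mem_support.1 ht)
    · exact stepCount_orderOf_le hπ hgen (Perm.mem_support.1 ht) hs
  have h2 : D * stepCount π α s n = n * stepCount π α s D := by
    rw [← stepCount_mul π α s hn, ← stepCount_mul π α s (hD s), mul_comm]
  refine Nat.eq_of_mul_eq_mul_left hD0 ?_
  calc D * (stepCount π α s n * #π.support) = n * (#π.support * stepCount π α s D) := by
        rw [← mul_assoc, h2]; ring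
    _ = _ := by rw [h1]; ring

/-- A step vector of the lattice of relations with the slope of `π` is a period of `π`. -/
theorem pow_apply_eq_self_of_slope (hπ : ∀ t, π t = t ∨ π t = t + α ∨ π t = t + β) (hα : α ≠ 0)
    (hgen : ∀ g : G, ∃ u w : ℕ, w ≤ u ∧ g = u • α - w • β) {s : G} (hs : π s ≠ s)
    {p n : ℕ} (hrel : (p : ℤ) • α + ((n : ℤ) - p) • β = 0)
    (hslope : p * #π.support = n * #{t | π t = t + α}) : (π ^ n) s = s := by
  -- A window of `n` steps with exactly `p` steps `α` closes up by `hrel`, and injectivity moves the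
  -- closure back to `s`.
  by_cases h : ∃ m, stepCount π α s (n + m) = stepCount π α s m + p
  · obtain ⟨m, hm⟩ := h
    have h1 : (π ^ (n + m)) s = (π ^ m) s := by
      rw [pow_apply_eq_add hπ hs, pow_apply_eq_add hπ hs, hm]
      rw [← sub_eq_zero, ← hrel]
      push_cast; module
    rw [add_comm, pow_add, Perm.mul_apply] at h1
    exact (π ^ m).injective h1
  exfalso
  push Not at h
  set D := orderOf π
  have hD0 : 0 < D := orderOf_pos π
  have hD (t : G) : (π ^ D) t = t := by simp [D, pow_orderOf_eq_one]
  have hsupp : 0 < #π.support := card_pos.2 ⟨s, Perm.mem_support.2 hs⟩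
  have key : stepCount π α s (D * n) = D * p := by
    have h1 := stepCount_mul_card_support hπ hα hgen hs (hD s)
    rw [mul_comm D n, stepCount_mul π α s (hD s)]
    refine Nat.eq_of_mul_eq_mul_right hsupp ?_
    rw [mul_assoc, h1, mul_assoc, hslope]; ring
  have hstep' (m : ℕ) : stepCount π α s (n + (m + 1)) + stepCount π α s m ≤
      stepCount π α s (n + m) + stepCount π α s (m + 1) + 1 ∧
      stepCount π α s (n + m) + stepCount π α s (m + 1) ≤
      stepCount π α s (n + (m + 1)) + stepCount π α s m + 1 := by
    rw [← add_assoc, stepCount_succ, stepCount_succ]; split_ifs <;> constructor <;> omega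
  -- Shifting the window by one changes its count by at most one, so counts that avoid `p` stay on
  -- one side of it. Cutting `D * n` steps into `D` windows then contradicts `key`.
  rcases lt_or_gt_of_ne (h 0) with h0 | h0
  · have hall (m : ℕ) : stepCount π α s (n + m) < stepCount π α s m + p := by
      induction m with
      | zero => exact h0
      | succ m ih => have := h (m + 1); have := hstep' m; omega
    have : ∀ i : ℕ, stepCount π α s (i * n) + i ≤ i * p := by
      intro i
      induction i with
      | zero => simp [stepCount_zero]
      | succ i ih => rw [Nat.succ_mul, Nat.succ_mul, add_comm (i * n)]; have := hall (i * n); omega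
    have := this D
    omega
  · have hall (m : ℕ) : stepCount π α s m + p < stepCount π α s (n + m) := by
      induction m with
      | zero => exact h0
      | succ m ih => have := h (m + 1); have := hstep' m; omega
    have : ∀ i : ℕ, i * p + i ≤ stepCount π α s (i * n) := by
      intro i
      induction i with
      | zero => simp
      | succ i ih => rw [Nat.succ_mul, Nat.succ_mul, add_comm (i * n)]; have := hall (i * n); omega
    have := this D
    omega

/-- A period of `π` gives a relation between `α` and `β` of the common slope, and such a relation is
a period of `π'`. -/
theorem pow_apply_eq_self_of_pow_apply_eq_self {π' : Perm G}
    (hπ : ∀ t, π t = t ∨ π t = t + α ∨ π t = t + β)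
    (hπ' : ∀ t, π' t = t ∨ π' t = t + α ∨ π' t = t + β) (hα : α ≠ 0)
    (hgen : ∀ g : G, ∃ u w : ℕ, w ≤ u ∧ g = u • α - w • β)
    (hsupp : #π.support = #π'.support) (hcard : #{t | π t = t + α} = #{t | π' t = t + α})
    {s s' : G} (hs : π s ≠ s) (hs' : π' s' ≠ s') {n : ℕ} (hn : (π ^ n) s = s) :
    (π' ^ n) s' = s' := by
  refine pow_apply_eq_self_of_slope hπ' hα hgen hs' (p := stepCount π α s n) ?_ ?_
  · have := pow_apply_eq_add hπ hs n
    rw [hn] at this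
    simpa using this.symm
  · rw [← hsupp, ← hcard]
    exact stepCount_mul_card_support hπ hα hgen hs hn

/-- The sign of a permutation all of whose steps are `0`, `α` or `β` depends only on the numbers
of the steps. -/
theorem sign_eq_of_card_steps_eq {π' : Perm G}
    (hπ : ∀ t, π t = t ∨ π t = t + α ∨ π t = t + β)
    (hπ' : ∀ t, π' t = t ∨ π' t = t + α ∨ π' t = t + β) (hα : α ≠ 0)
    (hgen : ∀ g : G, ∃ u w : ℕ, w ≤ u ∧ g = u • α - w • β)
    (hsupp : #π.support = #π'.support) (hcard : #{t | π t = t + α} = #{t | π' t = t + α}) :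
    Perm.sign π = Perm.sign π' := by
  -- Each cycle length of one permutation is a period for the other. Hence both cycle types are
  -- constant, with the same value and the same sum.
  have heq : ∀ r ∈ π.cycleType, ∀ r' ∈ π'.cycleType, r = r' := by
    intro r hr r' hr'
    obtain ⟨s, hs, h⟩ := exists_period_of_mem_cycleType hr
    obtain ⟨s', hs', h'⟩ := exists_period_of_mem_cycleType hr'
    refine Nat.dvd_antisymm ?_ ?_
    · exact (h _).1 (pow_apply_eq_self_of_pow_apply_eq_self hπ' hπ hα hgen hsupp.symm hcard.symm
        hs' hs ((h' _).2 dvd_rfl))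
    · exact (h' _).1 (pow_apply_eq_self_of_pow_apply_eq_self hπ hπ' hα hgen hsupp hcard
        hs hs' ((h _).2 dvd_rfl))
  suffices π.cycleType = π'.cycleType by rw [Perm.sign_of_cycleType, Perm.sign_of_cycleType, this]
  have hsum : π.cycleType.sum = π'.cycleType.sum := by
    rw [Perm.sum_cycleType, Perm.sum_cycleType, hsupp]
  rcases π.cycleType.empty_or_exists_mem with h0 | ⟨r, hr⟩
  · have : π' = 1 := by
      rw [h0, Multiset.sum_zero, Perm.sum_cycleType] at hsum
      exact Perm.card_support_eq_zero.1 hsum.symm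
    rw [h0, this, Perm.cycleType_one]
  rcases π'.cycleType.empty_or_exists_mem with h0 | ⟨r', hr'⟩
  · have : π = 1 := by
      rw [h0, Multiset.sum_zero, Perm.sum_cycleType] at hsum
      exact Perm.card_support_eq_zero.1 hsum
    rw [h0, this, Perm.cycleType_one]
  have h1 := Multiset.eq_replicate_card.2 fun x hx => heq x hx r' hr'
  have h2 := Multiset.eq_replicate_card.2 fun x hx => (heq r hr x hx).symm
  rw [heq r hr r' hr'] at h2
  have hr0 : 0 < r' := (Perm.one_lt_of_mem_cycleType hr').le
  rw [h1, h2, Multiset.sum_replicate, Multiset.sum_replicate, smul_eq_mul, smul_eq_mul] at hsum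
  rw [h1, h2, Nat.eq_of_mul_eq_mul_right hr0 hsum]

end LatticePaths

/-! ### Interval exchanges realizing prescribed step counts -/

section StepPermutation

open Equiv Finset

theorem sum_range_mul_of_periodic {c : ℕ → ℕ} {n : ℕ} (hc : ∀ v, c (v + n) = c v) (m : ℕ) :
    ∑ v ∈ range (m * n), c v = m * ∑ v ∈ range n, c v := by
  induction m with
  | zero => simp
  | succ m ih =>
    have hper : ∀ i v, c (i * n + v) = c v := by
      intro i v
      induction i with
      | zero => simp
      | succ i ih => rw [← ih, ← hc (i * n + v)]; congr 1; ring
    rw [Nat.succ_mul, sum_range_add, ih, Nat.succ_mul]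
    simp only [hper]

/-- The sum over `d * k` terms can be cut into blocks of either period, so both blocks have the same
average, which is `1`. -/
theorem sum_range_of_periodic {c : ℕ → ℕ} {d k : ℕ} (hd : 0 < d) (hcd : ∀ v, c (v + d) = c v)
    (hck : ∀ v, c (v + k) = c v) (hsum : ∑ v ∈ range d, c v = d) : ∑ v ∈ range k, c v = k := by
  have h1 := sum_range_mul_of_periodic hck d
  have h2 := sum_range_mul_of_periodic hcd k
  rw [mul_comm k d, h1, hsum, mul_comm k d] at h2
  exact Nat.eq_of_mul_eq_mul_left hd h2

variable {d : ℕ} [NeZero d]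

theorem card_val_lt (s : ZMod d) {k : ℕ} (hk : k ≤ d) :
    #{t : ZMod d | (s * t).val < k} = ∑ v ∈ range k, #{t : ZMod d | s * t = v} := by
  rw [card_eq_sum_card_fiberwise (f := fun t => (s * t).val) (t := range k) (by
    intro t; simp)]
  refine sum_congr rfl fun v hv => congrArg card ?_
  ext t
  have hv' := mem_range.1 hv
  simp only [mem_filter, mem_univ, true_and]
  constructor
  · rintro ⟨-, rfl⟩; exact (ZMod.natCast_zmod_val _).symm
  · intro h
    rw [h, ZMod.val_cast_of_lt (by omega)]
    exact ⟨hv', rfl⟩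

/-- If `k` is a multiple of `s` in `ℤ/d`, then multiplication by `s` equidistributes among the
first `k` residues. -/
theorem card_val_lt_eq {s g : ZMod d} {k : ℕ} (hg : s * g = k) (hk : k ≤ d) :
    #{t : ZMod d | (s * t).val < k} = k := by
  rw [card_val_lt s hk]
  refine sum_range_of_periodic (NeZero.pos d) (fun v => by simp) (fun v => ?_) ?_
  · refine card_bij (fun t _ => t - g) ?_ (fun _ _ _ _ h => by simpa using h) ?_
    · intro t; simp only [mem_filter, mem_univ, true_and]; intro h
      rw [mul_sub, h, hg]; push_cast; ring
    · intro t; simp only [mem_filter, mem_univ, true_and]; intro h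
      exact ⟨t + g, by rw [mul_add, h, hg]; push_cast; ring, by ring⟩
  · rw [← card_val_lt s le_rfl]
    simp [ZMod.val_lt]

variable {α β s : ZMod d} {j k : ℕ}

/-- Exchange of two intervals of residues. -/
def intervalStep (α β s : ZMod d) (j k : ℕ) (t : ZMod d) : ZMod d :=
  if (s * t).val < k then t + β else if (s * t).val < j + k then t + α else t

theorem val_mul_add_right (hsβ : s * β = j) (hjk : j + k ≤ d) {t : ZMod d}
    (ht : (s * t).val < k) : (s * (t + β)).val = (s * t).val + j := by
  have h : s * (t + β) = ((s * t).val + j : ℕ) := by simp [mul_add, hsβ]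
  rw [h, ZMod.val_cast_of_lt (by omega)]

theorem val_mul_add_left (hsα : s * α = -k) {t : ZMod d}
    (ht : k ≤ (s * t).val) : (s * (t + α)).val = (s * t).val - k := by
  have := ZMod.val_lt (s * t)
  have h : s * (t + α) = ((s * t).val - k : ℕ) := by
    simp [Nat.cast_sub ht, mul_add, hsα, sub_eq_add_neg]
  rw [h, ZMod.val_cast_of_lt (by omega)]

/-- The three branches land in the disjoint residue ranges `[j, j + k)`, `[0, j)` and `[j + k, d)`,
and each branch is a translation. -/
theorem intervalStep_injective (hsα : s * α = -k) (hsβ : s * β = j) (hjk : j + k ≤ d) :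
    Function.Injective (intervalStep α β s j k) := by
  intro t t' h
  unfold intervalStep at h
  have hv := congrArg (fun u => (s * u).val) h
  split_ifs at h hv with h1 h2 h3 h4 h5 h6 h7
  · simpa using h
  · rw [val_mul_add_right hsβ hjk h1, val_mul_add_left hsα (by omega)] at hv; omega
  · rw [val_mul_add_right hsβ hjk h1] at hv; omega
  · rw [val_mul_add_left hsα (by omega), val_mul_add_right hsβ hjk (by assumption)] at hv; omega
  · simpa using h
  · rw [val_mul_add_left hsα (by omega)] at hv; omega
  · rw [val_mul_add_right hsβ hjk (by assumption)] at hv; omega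
  · rw [val_mul_add_left hsα (by omega)] at hv; omega
  · exact h

/-- There is a permutation of `ℤ/d` with `j` steps `α`, `k` steps `β` and no other nonzero step,
provided `j α + k β = 0`. -/
theorem exists_perm_card_steps (hα : α ≠ 0) (hβ : β ≠ 0) (hαβ : α ≠ β)
    (hgen : ∃ u v : ZMod d, u * α + v * β = 1) (hrel : j * α + k * β = 0) (hjk : j + k ≤ d) :
    ∃ π : Perm (ZMod d), (∀ t, π t = t ∨ π t = t + α ∨ π t = t + β) ∧
      #{t | π t = t + α} = j ∧ #{t | π t = t + β} = k := by
  obtain ⟨u, v, huv⟩ := hgen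
  -- Chosen so that a step `β` raises the residue of `s * t` by `j` and a step `α` lowers it by `k`.
  -- It need not be a unit, so the interval sizes come from `card_val_lt_eq`.
  let s : ZMod d := v * j - u * k
  have hsα : s * α = -k := by
    linear_combination v * hrel - k * huv
  have hsβ : s * β = j := by
    linear_combination -u * hrel + j * huv
  have hinj := intervalStep_injective hsα hsβ hjk
  let π : Perm (ZMod d) := Equiv.ofBijective _ (Finite.injective_iff_bijective.1 hinj)
  have hπ (t : ZMod d) : π t = intervalStep α β s j k t := rfl
  have hk := card_val_lt_eq (s := s) (g := -α) (k := k) (by rw [mul_neg, hsα, neg_neg]) (by omega)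
  have hjk' := card_val_lt_eq (s := s) (g := β - α) (k := j + k)
    (by rw [mul_sub, hsα, hsβ]; push_cast; ring) hjk
  refine ⟨π, fun t => ?_, ?_, ?_⟩
  · rw [hπ, intervalStep]; split_ifs <;> simp
  · have h1 : ({t | π t = t + α} : Finset (ZMod d)) =
        ({t | (s * t).val < j + k} : Finset (ZMod d)) \
          ({t | (s * t).val < k} : Finset (ZMod d)) := by
      ext t
      simp only [mem_filter, mem_univ, true_and, mem_sdiff, hπ, intervalStep]
      split_ifs with h1 h2
      · simp [hαβ.symm, h1]
      · simp [h1, h2]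
      · simp [h2, hα]
    rw [h1, card_sdiff_of_subset (fun t => by simp; omega), hk, hjk']
    omega
  · rw [← hk]
    refine congrArg card ?_
    ext t
    simp only [mem_filter, mem_univ, true_and, hπ, intervalStep]
    split_ifs with h1 h2
    · simp [h1]
    · simp [h1, hαβ]
    · simp [h1, hβ]

end StepPermutation

/-! ### Leibniz expansion of the determinant of `x I + y P_α + z P_β` -/

section StepMatrix

open Equiv Finset MvPolynomial

/-- The matrix `x I + y P_α + z P_β`, where `P_γ` is the matrix of the translation by `γ`. -/
noncomputable def stepMatrix (R : Type*) [CommRing R] {G : Type*} [AddCommGroup G] [DecidableEq G]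
    (α β : G) : Matrix G G (MvPolynomial (Fin 3) R) :=
  fun u t => if u = t then X 0 else if u = t + α then X 1 else if u = t + β then X 2 else 0

variable {R : Type*} [CommRing R] {G : Type*} [AddCommGroup G] [DecidableEq G] [Fintype G]
  {α β : G}

theorem prod_stepMatrix_eq_zero {π : Perm G} (hπ : ¬ ∀ t, π t = t ∨ π t = t + α ∨ π t = t + β) :
    ∏ t, stepMatrix R α β (π t) t = 0 := by
  push Not at hπ
  obtain ⟨t, h0, h1, h2⟩ := hπ
  exact prod_eq_zero (mem_univ t) (by simp [stepMatrix, h0, h1, h2])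

/-- The exponent vector of the numbers of steps of `π` of the three kinds. -/
noncomputable def stepExponent (π : Perm G) (α : G) : Fin 3 →₀ ℕ :=
  ∑ t, Finsupp.single (if π t = t then 0 else if π t = t + α then 1 else 2) 1

theorem prod_stepMatrix {π : Perm G} (hπ : ∀ t, π t = t ∨ π t = t + α ∨ π t = t + β) :
    ∏ t, stepMatrix R α β (π t) t = monomial (stepExponent π α) 1 := by
  rw [stepExponent, monomial_sum_one]
  refine prod_congr rfl fun t _ => ?_
  unfold stepMatrix
  split_ifs with h0 h1 h2
  · rfl
  · rfl
  · rfl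
  · exact absurd (hπ t) (by simp [h0, h1, h2])

theorem stepExponent_zero (π : Perm G) (α : G) :
    stepExponent π α 0 + #π.support = Fintype.card G := by
  have : stepExponent π α 0 = #{t | π t = t} := by
    simp only [stepExponent, Finsupp.finsetSum_apply, card_filter]
    refine sum_congr rfl fun t _ => ?_
    split_ifs <;> simp
  rw [this, ← Finset.card_univ, ← card_filter_add_card_filter_not (s := univ) (fun t => π t = t)]
  rfl

theorem stepExponent_one (π : Perm G) (hα : α ≠ 0) :
    stepExponent π α 1 = #{t | π t = t + α} := by
  simp only [stepExponent, Finsupp.finsetSum_apply, card_filter]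
  refine sum_congr rfl fun t _ => ?_
  split_ifs with h0 h1 h1
  · rw [h0] at h1; exact absurd (by simpa using h1) hα
  all_goals simp

theorem stepExponent_two {π : Perm G} (hπ : ∀ t, π t = t ∨ π t = t + α ∨ π t = t + β)
    (hβ : β ≠ 0) (hαβ : α ≠ β) : stepExponent π α 2 = #{t | π t = t + β} := by
  simp only [stepExponent, Finsupp.finsetSum_apply, card_filter]
  refine sum_congr rfl fun t _ => ?_
  split_ifs with h0 h1 h1 h2 h3
  · rw [h0] at h1; exact absurd (by simpa using h1) hβ
  · simp
  · rw [h1] at h2; exact absurd (by simpa using h2) hαβ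
  · simp
  · simp
  · exact absurd (hπ t) (by simp [*])

theorem degree_stepExponent (π : Perm G) (α : G) : (stepExponent π α).degree = Fintype.card G := by
  simp [stepExponent, map_sum]

/-- All terms of the expansion of the determinant of `stepMatrix` which contribute to a given
monomial have the same sign. -/
theorem coeff_det_stepMatrix_ne_zero [CharZero R] (hα : α ≠ 0)
    (hgen : ∀ g : G, ∃ u w : ℕ, w ≤ u ∧ g = u • α - w • β) {π : Perm G}
    (hπ : ∀ t, π t = t ∨ π t = t + α ∨ π t = t + β) :
    coeff (stepExponent π α) (stepMatrix R α β).det ≠ 0 := by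
  classical
  have key : coeff (stepExponent π α) (stepMatrix R α β).det = (Perm.sign π : ℤ) *
      (#{τ : Perm G | (∀ t, τ t = t ∨ τ t = t + α ∨ τ t = t + β) ∧
        stepExponent τ α = stepExponent π α} : R) := by
    rw [Matrix.det_apply, coeff_sum, card_filter, Nat.cast_sum, mul_sum]
    refine sum_congr rfl fun τ _ => ?_
    by_cases hτ : ∀ t, τ t = t ∨ τ t = t + α ∨ τ t = t + β
    · rw [prod_stepMatrix hτ, Units.smul_def, coeff_smul, coeff_monomial, zsmul_eq_mul]
      by_cases he : stepExponent τ α = stepExponent π α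
      · have hsupp : #τ.support = #π.support := by
          have h1 := stepExponent_zero τ α
          have h2 := stepExponent_zero π α
          rw [he] at h1
          omega
        have hcard : #{t | τ t = t + α} = #{t | π t = t + α} := by
          rw [← stepExponent_one τ hα, ← stepExponent_one π hα, he]
        rw [sign_eq_of_card_steps_eq hτ hπ hα hgen hsupp hcard]
        simp only [hτ, he, implies_true, and_self, if_true, Nat.cast_one]
      · simp [he]
    · rw [prod_stepMatrix_eq_zero hτ, smul_zero, coeff_zero, if_neg (fun h => hτ h.1)]
      simp
  rw [key]
  have hpos : #{τ : Perm G | (∀ t, τ t = t ∨ τ t = t + α ∨ τ t = t + β) ∧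
        stepExponent τ α = stepExponent π α} ≠ 0 :=
    card_ne_zero.2 ⟨π, by simp only [mem_filter, mem_univ, true_and, and_true]; exact hπ⟩
  rcases Int.units_eq_one_or (Perm.sign π) with h | h <;> simp only [h] <;> simpa using hpos

end StepMatrix

/-! ### The norm of `x + y + z` as a circulant determinant -/

section Circulant

open Finset MvPolynomial

theorem pow_mul_val_add {M : Type*} [CommMonoid M] {e : M} {d : ℕ} [NeZero d] (he : e ^ d = 1)
    (n a : ℕ) (t : ZMod d) :
    e ^ (n * (t + (a : ZMod d)).val) = e ^ (n * t.val) * e ^ (a * n) := by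
  rw [← pow_add, ← mul_comm n a, ← mul_add]
  refine pow_eq_pow_of_modEq (Nat.ModEq.mul_left n ?_) he
  rw [← ZMod.natCast_eq_natCast_iff]
  simp

/-- The linear form `x + e^{an} y + e^{bn} z`. -/
noncomputable def linearFactor {R : Type*} [CommRing R] (e : R) (a b n : ℕ) :
    MvPolynomial (Fin 3) R :=
  X 0 + C (e ^ (a * n)) * X 1 + C (e ^ (b * n)) * X 2

theorem exists_natCast_combination {d a b : ℕ} [NeZero d] (hgcd : Nat.gcd (Nat.gcd a b) d = 1) :
    ∃ u v : ℕ, (u * a + v * b : ZMod d) = 1 := by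
  have h1 : ((Nat.gcd a b : ℕ) : ZMod d) * ((Nat.gcd a b : ℕ) : ZMod d)⁻¹ = 1 :=
    ZMod.coe_mul_inv_eq_one _ hgcd
  have h2 : ((Nat.gcd a b : ℕ) : ZMod d) =
      a * (Nat.gcdA a b : ZMod d) + b * (Nat.gcdB a b : ZMod d) := by
    have := congrArg (Int.cast : ℤ → ZMod d) (Nat.gcd_eq_gcd_ab a b)
    push_cast at this
    exact this
  set g := ((Nat.gcd a b : ℕ) : ZMod d)⁻¹
  refine ⟨(g * (Nat.gcdA a b : ZMod d)).val, (g * (Nat.gcdB a b : ZMod d)).val, ?_⟩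
  rw [ZMod.natCast_zmod_val, ZMod.natCast_zmod_val, ← h1, h2]
  ring

variable {R : Type*} [CommRing R] [IsDomain R] {d : ℕ} [NeZero d]

theorem det_fourier_ne_zero {e : R} (he : IsPrimitiveRoot e d) :
    (Matrix.of fun u v : ZMod d => e ^ (u.val * v.val)).det ≠ 0 := by
  obtain ⟨n, rfl⟩ := Nat.exists_eq_succ_of_ne_zero (NeZero.ne d)
  have : (Matrix.of fun u v : ZMod (n + 1) => e ^ (u.val * v.val)) =
      Matrix.vandermonde fun i : Fin (n + 1) => e ^ (i : ℕ) := by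
    ext u v
    exact pow_mul e _ _
  rw [this]
  refine Matrix.det_vandermonde_ne_zero_iff.2 fun i j h => ?_
  exact Fin.ext (he.pow_inj i.2 j.2 h)

/-- The rows of the Fourier matrix are left eigenvectors of the circulant matrix with the linear
factors as eigenvalues; its Vandermonde determinant can be cancelled. -/
theorem det_stepMatrix {e : R} (he : IsPrimitiveRoot e d) {a b : ℕ} (ha : (a : ZMod d) ≠ 0)
    (hb : (b : ZMod d) ≠ 0) (hab : (a : ZMod d) ≠ b) :
    (stepMatrix R (a : ZMod d) b).det = ∏ t : ZMod d, linearFactor e a b t.val := by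
  have he' : IsPrimitiveRoot (C e : MvPolynomial (Fin 3) R) d :=
    he.map_of_injective (C_injective (Fin 3) R)
  set V : Matrix (ZMod d) (ZMod d) (MvPolynomial (Fin 3) R) :=
    Matrix.of fun u v => C e ^ (u.val * v.val) with hV
  have hM : V * stepMatrix R (a : ZMod d) b =
      Matrix.diagonal (fun t : ZMod d => linearFactor e a b t.val) * V := by
    ext1 v t
    rw [Matrix.diagonal_mul, Matrix.mul_apply]
    have hsplit (u : ZMod d) : stepMatrix R (a : ZMod d) b u t = (if u = t then X 0 else 0) +
        (if u = t + a then X 1 else 0) + (if u = t + b then X 2 else 0) := by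
      unfold stepMatrix
      split_ifs with h0 h1 h2 h2 h3 <;> simp_all
    simp only [hsplit, mul_add, sum_add_distrib, mul_ite, mul_zero, sum_ite_eq', mem_univ, if_true]
    simp only [hV, Matrix.of_apply, pow_mul_val_add he'.pow_eq_one, linearFactor, C_pow]
    ring
  have hdet := congrArg Matrix.det hM
  rw [Matrix.det_mul, Matrix.det_mul, Matrix.det_diagonal, mul_comm] at hdet
  exact mul_right_cancel₀ (det_fourier_ne_zero he') hdet

/-- Every invariant monomial of degree `d` occurs in the norm of `x + y + z`. -/
theorem coeff_prod_linearFactor_ne_zero [CharZero R] {e : R} (he : IsPrimitiveRoot e d) {a b : ℕ}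
    (ha : (a : ZMod d) ≠ 0) (hb : (b : ZMod d) ≠ 0) (hab : (a : ZMod d) ≠ b)
    (hgcd : Nat.gcd (Nat.gcd a b) d = 1) {m : Fin 3 →₀ ℕ} (hm : m.degree = d)
    (hinv : d ∣ a * m 1 + b * m 2) :
    coeff m (∏ t : ZMod d, linearFactor e a b t.val) ≠ 0 := by
  have hdeg : m 0 + m 1 + m 2 = d := by
    rw [← hm, Finsupp.degree_eq_sum, Fin.sum_univ_three]
  obtain ⟨u, v, huv⟩ := exists_natCast_combination hgcd
  obtain ⟨π, hπ, h1, h2⟩ := exists_perm_card_steps (j := m 1) (k := m 2) ha hb hab ⟨u, v, huv⟩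
    (by
      have := (ZMod.natCast_eq_zero_iff _ d).2 hinv
      push_cast at this
      linear_combination this) (by omega)
  have hexp : stepExponent π (a : ZMod d) = m := by
    have e1 := stepExponent_one π ha
    have e2 := stepExponent_two hπ hb hab
    have e0 := degree_stepExponent π (a : ZMod d)
    rw [Finsupp.degree_eq_sum, Fin.sum_univ_three, ZMod.card] at e0
    rw [h1] at e1
    rw [h2] at e2
    ext i
    fin_cases i
    · show stepExponent π (a : ZMod d) 0 = m 0
      omega
    · exact e1
    · exact e2
  rw [← det_stepMatrix he ha hb hab, ← hexp]
  refine coeff_det_stepMatrix_ne_zero ha (fun g => ?_) hπ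
  -- From `g = (g u) a - (-g v) b`; the added `d` vanishes in `ZMod d` and secures `w ≤ u`.
  refine ⟨(g * u).val + d, (-g * v).val, ?_, ?_⟩
  · have := ZMod.val_lt (-g * v : ZMod d)
    omega
  · simp
    linear_combination (-g) * huv

end Circulant

/-! ### Spans of monomials and their dimensions -/

section MonomialSpans

open Finset MvPolynomial

variable {σ K : Type*} [Field K]

theorem isHomogeneous_iff_degree {n : ℕ} {F : MvPolynomial σ K} :
    F.IsHomogeneous n ↔ ∀ s ∈ F.support, s.degree = n := by
  simp only [IsHomogeneous, IsWeightedHomogeneous, mem_support_iff, Finsupp.degree_eq_weight_one]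
  rfl

theorem mem_span_monomial_iff {T : Set (σ →₀ ℕ)} {F : MvPolynomial σ K} :
    F ∈ Submodule.span K ((fun s => monomial s (1 : K)) '' T) ↔ ∀ s ∈ F.support, s ∈ T := by
  constructor
  · intro h
    induction h using Submodule.span_induction with
    | mem x hx =>
      classical
      obtain ⟨s, hs, rfl⟩ := hx
      intro t ht
      rw [mem_support_iff, coeff_monomial] at ht
      have : s = t := by by_contra h; simp [h] at ht
      exact this ▸ hs
    | zero => simp
    | add x y _ _ hx hy =>
      classical
      intro s hs
      rcases Finset.mem_union.1 (support_add hs) with h | h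
      · exact hx s h
      · exact hy s h
    | smul c x _ hx => exact fun s hs => hx s (support_smul hs)
  · intro h
    rw [F.as_sum]
    refine Submodule.sum_mem _ fun s hs => ?_
    have : monomial s (coeff s F) = coeff s F • monomial s (1 : K) := by
      rw [smul_monomial, smul_eq_mul, mul_one]
    rw [this]
    exact Submodule.smul_mem _ _ (Submodule.subset_span ⟨s, h s hs, rfl⟩)

theorem finrank_span_monomial (T : Finset (σ →₀ ℕ)) :
    Module.finrank K (Submodule.span K ((fun s => monomial s (1 : K)) '' (T : Set (σ →₀ ℕ)))) =
      #T := by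
  have hli := ((basisMonomials σ K).linearIndependent).comp ((↑) : T → (σ →₀ ℕ))
    Subtype.val_injective
  have h := finrank_span_eq_card hli
  rw [Fintype.card_coe] at h
  have hr : Set.range (basisMonomials σ K ∘ ((↑) : T → (σ →₀ ℕ))) =
      (fun s => monomial s (1 : K)) '' (T : Set (σ →₀ ℕ)) := by
    rw [Set.range_comp, Subtype.range_coe, coe_basisMonomials]
  rwa [hr] at h

theorem homogeneousSubmodule_eq_span [Fintype σ] [DecidableEq σ] (n : ℕ) :
    homogeneousSubmodule σ K n = Submodule.span K ((fun s => monomial s (1 : K)) ''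
      ((univ : Finset σ).finsuppAntidiag n : Set (σ →₀ ℕ))) := by
  ext F
  rw [mem_homogeneousSubmodule, isHomogeneous_iff_degree, mem_span_monomial_iff]
  simp [Finsupp.degree_eq_sum]

theorem finrank_homogeneousSubmodule_three (n : ℕ) :
    Module.finrank K (homogeneousSubmodule (Fin 3) K n) = (n + 2).choose 2 := by
  rw [homogeneousSubmodule_eq_span, finrank_span_monomial, card_finsuppAntidiag_nat_eq_choose,
    card_univ, Fintype.card_fin, show 3 + n - 1 = n + 2 by omega, Nat.choose_symm_add]

/-- The forms of degree `d` in an ideal generated by monomials of degree `d`. -/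
theorem mem_span_monomial_iff_of_isHomogeneous {d : ℕ} {T : Set (σ →₀ ℕ)}
    (hT : ∀ s ∈ T, s.degree = d) {F : MvPolynomial σ K} (hF : F.IsHomogeneous d) :
    F ∈ Ideal.span ((fun s => monomial s (1 : K)) '' T) ↔ ∀ s ∈ F.support, s ∈ T := by
  rw [mem_ideal_span_monomial_image]
  refine forall₂_congr fun s hs => ⟨?_, fun h => ⟨s, h, le_rfl⟩⟩
  rintro ⟨t, ht, hts⟩
  have h1 := isHomogeneous_iff_degree.1 hF s hs
  obtain ⟨r, rfl⟩ := exists_add_of_le hts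
  rw [map_add, hT t ht] at h1
  have : r = 0 := (Finsupp.degree_eq_zero_iff r).1 (by omega)
  simpa [this] using ht

end MonomialSpans

/-! ### The diagonal action and its invariant monomials -/

section Invariants

open Finset MvPolynomial

variable {K : Type*} [Field K]

/-- The exponents of the monomials of degree `d` invariant under `diag(1, e^a, e^b)`. -/
def invariantExponents (d a b : ℕ) : Finset (Fin 3 →₀ ℕ) :=
  {s ∈ (univ : Finset (Fin 3)).finsuppAntidiag d | d ∣ a * s 1 + b * s 2}

theorem mem_invariantExponents {d a b : ℕ} {s : Fin 3 →₀ ℕ} :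
    s ∈ invariantExponents d a b ↔ s.degree = d ∧ d ∣ a * s 1 + b * s 2 := by
  simp [invariantExponents, Finsupp.degree_eq_sum]

theorem matrixAction_diagMatrix_X (e : K) (a b : ℕ) (i : Fin 3) :
    matrixAction (n := 2) (diagMatrix e a b) (X i) = C (![1, e ^ a, e ^ b] i) * X i := by
  rw [matrixAction, aeval_X, Finset.sum_eq_single i]
  · simp [diagMatrix]
  · intro j _ hj
    simp [diagMatrix, Matrix.diagonal_apply_ne' _ hj]
  · simp

theorem matrixAction_diagMatrix_monomial (e : K) (a b : ℕ) (s : Fin 3 →₀ ℕ) (c : K) :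
    matrixAction (n := 2) (diagMatrix e a b) (monomial s c) =
      monomial s (e ^ (a * s 1 + b * s 2) * c) := by
  have hs : monomial s c = C c * ∏ i : Fin 3, (X i : MvPolynomial (Fin 3) K) ^ s i := by
    rw [monomial_eq, Finsupp.prod_fintype _ _ (by simp)]
  have hs' : monomial s (e ^ (a * s 1 + b * s 2) * c) =
      C (e ^ (a * s 1 + b * s 2) * c) * ∏ i : Fin 3, (X i : MvPolynomial (Fin 3) K) ^ s i := by
    rw [monomial_eq, Finsupp.prod_fintype _ _ (by simp)]
  rw [hs, hs', map_mul, map_prod, ← algebraMap_eq, AlgHom.commutes]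
  simp only [map_pow, Fin.prod_univ_three, matrixAction_diagMatrix_X]
  simp [mul_pow, pow_add, pow_mul]
  ring

theorem coeff_matrixAction_diagMatrix (e : K) (a b : ℕ) (s : Fin 3 →₀ ℕ)
    (F : MvPolynomial (Fin 3) K) :
    coeff s (matrixAction (n := 2) (diagMatrix e a b) F) =
      e ^ (a * s 1 + b * s 2) * coeff s F := by
  induction F using MvPolynomial.induction_on' with
  | monomial t c =>
    rw [matrixAction_diagMatrix_monomial, coeff_monomial, coeff_monomial]
    split_ifs with h
    · rw [h]
    · simp
  | add p q hp hq => rw [map_add, coeff_add, coeff_add, hp, hq, mul_add]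

theorem matrixAction_diagMatrix_iterate_eq_self {d : ℕ} {e : K} (he : e ^ d = 1) (a b : ℕ)
    (F : MvPolynomial (Fin 3) K) :
    (matrixAction (n := 2) (diagMatrix e a b))^[d] F = F := by
  have h (n : ℕ) (s : Fin 3 →₀ ℕ) : coeff s ((matrixAction (n := 2) (diagMatrix e a b))^[n] F) =
      (e ^ (a * s 1 + b * s 2)) ^ n * coeff s F := by
    induction n with
    | zero => simp
    | succ n ih =>
      rw [Function.iterate_succ_apply', coeff_matrixAction_diagMatrix, ih, pow_succ', mul_assoc]
  ext s
  rw [h, ← pow_mul, mul_comm (_ + _), pow_mul, he, one_pow, one_mul]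

theorem isHomogeneous_matrixAction_diagMatrix (e : K) (a b : ℕ) {n : ℕ}
    {F : MvPolynomial (Fin 3) K} (hF : F.IsHomogeneous n) :
    (matrixAction (n := 2) (diagMatrix e a b) F).IsHomogeneous n := by
  rw [isHomogeneous_iff_degree] at hF ⊢
  intro s hs
  rw [mem_support_iff, coeff_matrixAction_diagMatrix] at hs
  exact hF s (mem_support_iff.2 (right_ne_zero_of_mul hs))

theorem matrixAction_diagMatrix_injective {e : K} (he : e ≠ 0) (a b : ℕ) :
    Function.Injective (matrixAction (n := 2) (diagMatrix e a b)) := by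
  intro F G h
  ext s
  have := congrArg (coeff s) h
  rw [coeff_matrixAction_diagMatrix, coeff_matrixAction_diagMatrix] at this
  exact mul_left_cancel₀ (pow_ne_zero _ he) this

variable {d a b : ℕ} {e : K}

theorem matrixAction_diagMatrix_eq_self_iff (he : IsPrimitiveRoot e d)
    {F : MvPolynomial (Fin 3) K} :
    matrixAction (n := 2) (diagMatrix e a b) F = F ↔ ∀ s ∈ F.support, d ∣ a * s 1 + b * s 2 := by
  rw [MvPolynomial.ext_iff]
  refine forall_congr' fun s => ?_
  rw [coeff_matrixAction_diagMatrix, mem_support_iff, ← he.pow_eq_one_iff_dvd]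
  by_cases h : coeff s F = 0
  · simp [h]
  · rw [mul_eq_right₀ h]; simp [h]

theorem invariantMonomialIdeal_diagMatrix (he : IsPrimitiveRoot e d) :
    invariantMonomialIdeal (n := 2) d (diagMatrix e a b) =
      Ideal.span ((fun s => monomial s (1 : K)) ''
        (invariantExponents d a b : Set (Fin 3 →₀ ℕ))) := by
  unfold invariantMonomialIdeal
  congr 1
  ext m
  constructor
  · rintro ⟨s, hs, rfl, h⟩
    refine ⟨s, mem_coe.2 (mem_invariantExponents.2 ⟨hs, ?_⟩), rfl⟩
    exact (matrixAction_diagMatrix_eq_self_iff he).1 h s (by simp [mem_support_iff])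
  · rintro ⟨s, hs, rfl⟩
    obtain ⟨h1, h2⟩ := mem_invariantExponents.1 (mem_coe.1 hs)
    refine ⟨s, h1, rfl, (matrixAction_diagMatrix_eq_self_iff he).2 fun t ht => ?_⟩
    rw [mem_support_iff, coeff_monomial] at ht
    have : s = t := by by_contra h; simp [h] at ht
    exact this ▸ h2

theorem mem_span_invariantExponents_iff (he : IsPrimitiveRoot e d) {F : MvPolynomial (Fin 3) K}
    (hF : F.IsHomogeneous d) :
    F ∈ Ideal.span ((fun s => monomial s (1 : K)) '' (invariantExponents d a b : Set (Fin 3 →₀ ℕ)))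
      ↔ matrixAction (n := 2) (diagMatrix e a b) F = F := by
  rw [mem_span_monomial_iff_of_isHomogeneous
    (fun s hs => (mem_invariantExponents.1 (mem_coe.1 hs)).1) hF,
    matrixAction_diagMatrix_eq_self_iff he]
  refine forall₂_congr fun s hs => ?_
  rw [mem_coe, mem_invariantExponents, isHomogeneous_iff_degree.1 hF s hs]
  simp

/-- Modulo `d`, the solutions of `a m₁ + b m₂ = 0` are `(g b, -g a)` with `g` in `ZMod d`. Apart
from `y^d` and `z^d` the exponents are below `d`, so `g` determines the monomial, and one value of
`g` never occurs. -/
theorem card_invariantExponents_le (ha : 0 < a) (hab : a < b) (hb : b < d)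
    (hgcd : Nat.gcd (Nat.gcd a b) d = 1) : #(invariantExponents d a b) ≤ d + 1 := by
  have : NeZero d := ⟨by omega⟩
  obtain ⟨u, v, huv⟩ := exists_natCast_combination hgcd
  set y : Fin 3 →₀ ℕ := Finsupp.single 1 d
  set z : Fin 3 →₀ ℕ := Finsupp.single 2 d
  set T := (invariantExponents d a b \ {y, z})
  have hT : ∀ s ∈ T, s 1 < d ∧ s 2 < d ∧ s 1 + s 2 ≤ d ∧
      (s 1 : ZMod d) = (v * s 1 - u * s 2) * b ∧ (s 2 : ZMod d) = -(v * s 1 - u * s 2) * a := by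
    intro s hs
    obtain ⟨hs1, hs2⟩ := mem_sdiff.1 hs
    obtain ⟨h1, h2⟩ := mem_invariantExponents.1 hs1
    rw [Finsupp.degree_eq_sum, Fin.sum_univ_three] at h1
    have h3 := (ZMod.natCast_eq_zero_iff _ d).2 h2
    push_cast at h3
    refine ⟨?_, ?_, by omega, ?_, ?_⟩
    · by_contra h
      refine hs2 (mem_insert.2 (Or.inl ?_))
      ext i; fin_cases i <;> simp [y] <;> omega
    · by_contra h
      refine hs2 (mem_insert.2 (Or.inr (mem_singleton.2 ?_)))
      ext i; fin_cases i <;> simp [z] <;> omega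
    · linear_combination (-(s 1 : ZMod d)) * huv + u * h3
    · linear_combination (-(s 2 : ZMod d)) * huv + v * h3
  have hcast {m n : ℕ} (hm : m < d) (hn : n < d) (h : (m : ZMod d) = n) : m = n := by
    rw [ZMod.natCast_eq_natCast_iff] at h
    exact Nat.ModEq.eq_of_lt_of_lt h hm hn
  have hcard : #T ≤ #((univ : Finset (ZMod d)).erase 1) := by
    refine card_le_card_of_injOn (fun s => (v * s 1 - u * s 2 : ZMod d)) ?_ ?_
    · intro s hs
      obtain ⟨h1, h2, h3, h4, h5⟩ := hT s hs
      -- The parameter `1` would give exponents `b` and `d - a`, whose sum exceeds `d` since `a <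
      -- b`.
      refine mem_coe.2 (mem_erase.2 ⟨fun h => ?_, mem_univ _⟩)
      dsimp only at h
      rw [h] at h4 h5
      have h4' : s 1 = b := hcast h1 hb (by simpa using h4)
      have h5' : s 2 = d - a := hcast h2 (by omega) (by
        rw [h5, Nat.cast_sub (by omega)]; simp)
      omega
    · intro s hs s' hs' h
      obtain ⟨h1, h2, h3, h4, h5⟩ := hT s hs
      obtain ⟨h1', h2', h3', h4', h5'⟩ := hT s' hs'
      dsimp only at h
      rw [h, ← h4'] at h4
      rw [h, ← h5'] at h5
      have e1 := hcast h1 h1' h4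
      have e2 := hcast h2 h2' h5
      have d1 := (mem_invariantExponents.1 (mem_sdiff.1 hs).1).1
      have d2 := (mem_invariantExponents.1 (mem_sdiff.1 hs').1).1
      rw [Finsupp.degree_eq_sum, Fin.sum_univ_three] at d1 d2
      ext i
      fin_cases i
      · show s 0 = s' 0
        omega
      · exact e1
      · exact e2
  rw [card_erase_of_mem (mem_univ _), card_univ, ZMod.card] at hcard
  have h1 := le_card_sdiff ({y, z} : Finset (Fin 3 →₀ ℕ)) (invariantExponents d a b)
  have h2 : #({y, z} : Finset (Fin 3 →₀ ℕ)) ≤ 2 := card_le_two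
  have h3 : #T = #(invariantExponents d a b \ {y, z}) := rfl
  omega

end Invariants

/-! ### Artinianity and failure of the weak Lefschetz property -/

section TogliattiSystem

open Finset MvPolynomial

variable {K : Type*} [Field K]

/-- The variables become nilpotent, so the quotient is integral and of finite type, hence
finite-dimensional over `K`. -/
theorem isArtinianRing_quotient_of_X_pow_mem {σ : Type*} [Finite σ] {I : Ideal (MvPolynomial σ K)}
    {d : ℕ} (h : ∀ i, (X i : MvPolynomial σ K) ^ d ∈ I) :
    IsArtinianRing (MvPolynomial σ K ⧸ I) := by
  have hint : Algebra.IsIntegral K (MvPolynomial σ K ⧸ I) := by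
    refine ⟨fun q => ?_⟩
    obtain ⟨F, rfl⟩ := Ideal.Quotient.mk_surjective q
    induction F using MvPolynomial.induction_on with
    | C c => exact isIntegral_algebraMap (R := K) (A := MvPolynomial σ K ⧸ I) (x := c)
    | add p q hp hq => rw [map_add]; exact hp.add hq
    | mul_X p i hp =>
      rw [map_mul]
      refine hp.mul ⟨Polynomial.X ^ (d + 1), Polynomial.monic_X_pow _, ?_⟩
      rw [Polynomial.eval₂_pow, Polynomial.eval₂_X, ← map_pow, Ideal.Quotient.eq_zero_iff_mem,
        pow_succ]
      exact I.mul_mem_right _ (h i)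
  have : Module.Finite K (MvPolynomial σ K ⧸ I) := Algebra.IsIntegral.finite
  exact IsArtinianRing.of_finite K _

variable {d a b : ℕ} {e : K}

/-- Every linear form divides a nonzero invariant form of degree `d`, its norm, with nonzero
cofactor. -/
theorem exists_mul_invariant (hd : 0 < d) (he : IsPrimitiveRoot e d) {L : MvPolynomial (Fin 3) K}
    (hL : L.IsHomogeneous 1) (hL0 : L ≠ 0) :
    ∃ F : MvPolynomial (Fin 3) K, F ≠ 0 ∧ F.IsHomogeneous (d - 1) ∧
      matrixAction (n := 2) (diagMatrix e a b) (L * F) = L * F := by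
  set φ := matrixAction (n := 2) (diagMatrix e a b) with hφ
  have hinj : Function.Injective φ := matrixAction_diagMatrix_injective (he.ne_zero (by omega)) a b
  have hne (n : ℕ) : φ^[n] L ≠ 0 := by
    have := (hinj.iterate n).ne hL0
    rwa [iterate_map_zero] at this
  have hhom (n : ℕ) : (φ^[n] L).IsHomogeneous 1 := by
    induction n with
    | zero => exact hL
    | succ n ih =>
      rw [Function.iterate_succ_apply']
      exact isHomogeneous_matrixAction_diagMatrix e a b ih
  obtain ⟨n, rfl⟩ := Nat.exists_eq_add_of_lt hd
  rw [zero_add] at *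
  refine ⟨∏ i ∈ range n, φ^[i + 1] L, prod_ne_zero_iff.2 fun i _ => hne _, ?_, ?_⟩
  · have := IsHomogeneous.prod (range n) (fun i => φ^[i + 1] L) (fun _ => 1) fun i _ => hhom _
    simpa using this
  · have h1 : L * ∏ i ∈ range n, φ^[i + 1] L = ∏ i ∈ range (n + 1), φ^[i] L := by
      rw [prod_range_succ', mul_comm, Function.iterate_zero_apply]
    rw [h1, map_prod]
    simp only [← Function.iterate_succ_apply' φ]
    rw [prod_range_succ, prod_range_succ' (fun i => φ^[i] L),
      matrixAction_diagMatrix_iterate_eq_self he.pow_eq_one, Function.iterate_zero_apply]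

theorem failsWLPInDegree_invariant (hd : 0 < d) (he : IsPrimitiveRoot e d)
    (hcard : #(invariantExponents d a b) ≤ d + 1) :
    FailsWLPInDegree (n := 2) (Ideal.span ((fun s => monomial s (1 : K)) ''
      (invariantExponents d a b : Set (Fin 3 →₀ ℕ)))) (d - 1) := by
  set I : Ideal (MvPolynomial (Fin 3) K) := Ideal.span ((fun s => monomial s (1 : K)) ''
      (invariantExponents d a b : Set (Fin 3 →₀ ℕ))) with hI
  have hdeg : ∀ s ∈ (invariantExponents d a b : Set (Fin 3 →₀ ℕ)), s.degree = d :=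
    fun s hs => (mem_invariantExponents.1 (mem_coe.1 hs)).1
  intro L hL
  obtain ⟨F, hF0, hFhom, hFI⟩ : ∃ F : MvPolynomial (Fin 3) K, F ≠ 0 ∧ F.IsHomogeneous (d - 1) ∧
      L * F ∈ Submodule.span K ((fun s => monomial s (1 : K)) ''
        (invariantExponents d a b : Set (Fin 3 →₀ ℕ))) := by
    by_cases hL0 : L = 0
    · refine ⟨X 0 ^ (d - 1), pow_ne_zero _ (X_ne_zero 0), ?_, ?_⟩
      · simpa using (isHomogeneous_X K (0 : Fin 3)).pow (d - 1)
      · rw [hL0, zero_mul]; exact zero_mem _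
    · obtain ⟨F, h0, h1, h2⟩ := exists_mul_invariant (a := a) (b := b) hd he hL hL0
      refine ⟨F, h0, h1, ?_⟩
      have hLF : (L * F).IsHomogeneous d := by
        have := hL.mul h1
        rwa [show 1 + (d - 1) = d by omega] at this
      exact mem_span_monomial_iff.2 ((mem_span_monomial_iff_of_isHomogeneous hdeg hLF).1
        ((mem_span_invariantExponents_iff he hLF).2 h2))
  have hsub : ∀ G ∈ Submodule.span K ((fun s => monomial s (1 : K)) ''
        (invariantExponents d a b : Set (Fin 3 →₀ ℕ))), G ∈ I := by
    intro G hG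
    exact mem_ideal_span_monomial_image.2 fun s hs => ⟨s, mem_span_monomial_iff.1 hG s hs, le_rfl⟩
  rintro (hinj | hsurj)
  · have h1 : Ideal.Quotient.mk I F = 0 := by
      refine hinj ⟨F, hFhom, rfl⟩ (zero_mem _) ?_
      have h : Ideal.Quotient.mk I L * Ideal.Quotient.mk I F = Ideal.Quotient.mk I L * 0 := by
        rw [← map_mul, mul_zero, Ideal.Quotient.eq_zero_iff_mem]
        exact hsub _ hFI
      exact h
    rw [Ideal.Quotient.eq_zero_iff_mem, hI, mem_ideal_span_monomial_image] at h1
    obtain ⟨s, hs⟩ := support_nonempty.2 hF0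
    obtain ⟨t, ht, hts⟩ := h1 s hs
    have h2 := isHomogeneous_iff_degree.1 hFhom s hs
    have h3 := hdeg t ht
    have h4 := Finsupp.degree_mono hts
    omega
  · set W := Submodule.span K ((fun s => monomial s (1 : K)) ''
        (invariantExponents d a b : Set (Fin 3 →₀ ℕ))) with hW
    set V := homogeneousSubmodule (Fin 3) K (d - 1) with hV
    have hVfin : FiniteDimensional K V :=
      Module.Finite.iff_fg.2 (homogeneousSubmodule_fg (Fin 3) K (d - 1))
    have hWfin : FiniteDimensional K W :=
      FiniteDimensional.span_of_finite K ((finite_toSet _).image _)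
    -- Surjectivity of `× L` says that the range of `Φ` contains all forms of degree `d`. The source
    -- has at most that dimension, and `(F, -L F)` is a nonzero kernel element.
    let Φ : (V × W) →ₗ[K] MvPolynomial (Fin 3) K :=
      ((LinearMap.mulLeft K L).comp V.subtype).coprod W.subtype
    have hΦ (p : V × W) : Φ p = L * p.1 + p.2 := rfl
    have hker : 0 < Module.finrank K (LinearMap.ker Φ) := by
      have hmem : ((⟨F, hFhom⟩ : V), -(⟨L * F, hFI⟩ : W)) ∈ LinearMap.ker Φ := by
        rw [LinearMap.mem_ker, hΦ]
        simp
      refine Nat.pos_of_ne_zero fun h => hF0 ?_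
      rw [Submodule.finrank_eq_zero.1 h, Submodule.mem_bot] at hmem
      exact congrArg (fun p : V × W => (p.1 : MvPolynomial (Fin 3) K)) hmem
    have hrange : homogeneousSubmodule (Fin 3) K d ≤ LinearMap.range Φ := by
      intro H hH
      have hH' : (Ideal.Quotient.mk I H) ∈ (gradedPiece (n := 2) I (d - 1 + 1) : Set _) :=
        ⟨H, by rw [show d - 1 + 1 = d by omega]; exact hH, rfl⟩
      obtain ⟨_, ⟨F', hF', rfl⟩, h⟩ := hsurj hH'
      have h1 : H - L * F' ∈ I := by
        rw [← Ideal.Quotient.eq_zero_iff_mem, map_sub, sub_eq_zero, map_mul]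
        exact h.symm
      have hLF' : (L * F').IsHomogeneous d := by
        have := hL.mul hF'
        rwa [show 1 + (d - 1) = d by omega] at this
      have h2 : (H - L * F').IsHomogeneous d := IsHomogeneous.sub hH hLF'
      have h3 : H - L * F' ∈ W :=
        mem_span_monomial_iff.2 ((mem_span_monomial_iff_of_isHomogeneous hdeg h2).1 h1)
      exact ⟨(⟨F', hF'⟩, ⟨_, h3⟩), by rw [hΦ]; ring⟩
    have h1 := Submodule.finrank_mono hrange
    have h2 := LinearMap.finrank_range_add_finrank_ker Φ
    have hVrank : Module.finrank K V = (d - 1 + 2).choose 2 :=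
      finrank_homogeneousSubmodule_three (d - 1)
    have hWrank : Module.finrank K W = #(invariantExponents d a b) := finrank_span_monomial _
    rw [Module.finrank_prod, hVrank, hWrank] at h2
    rw [finrank_homogeneousSubmodule_three] at h1
    obtain ⟨n, rfl⟩ := Nat.exists_eq_add_of_lt hd
    have h3 : (0 + n + 1 + 2).choose 2 = (0 + n + 1 + 1).choose 1 + (0 + n + 1 + 1).choose 2 :=
      Nat.choose_succ_succ _ _
    rw [Nat.choose_one_right] at h3
    rw [show 0 + n + 1 - 1 + 2 = 0 + n + 1 + 1 by omega] at h2
    omega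

theorem isMonomialTogliattiSystem_invariant (ha : 0 < a) (hab : a < b) (hb : b < d)
    (hgcd : Nat.gcd (Nat.gcd a b) d = 1) (he : IsPrimitiveRoot e d) :
    IsMonomialTogliattiSystem (n := 2) d (Ideal.span ((fun s => monomial s (1 : K)) ''
      (invariantExponents d a b : Set (Fin 3 →₀ ℕ)))) := by
  have hcard := card_invariantExponents_le ha hab hb hgcd
  refine ⟨⟨?_, ?_, failsWLPInDegree_invariant (by omega) he hcard⟩, ⟨_, rfl⟩⟩
  · refine isArtinianRing_quotient_of_X_pow_mem (d := d) fun i => Ideal.subset_span ?_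
    refine ⟨Finsupp.single i d, mem_coe.2 (mem_invariantExponents.2 ⟨by simp, ?_⟩), ?_⟩
    · refine dvd_add (Dvd.dvd.mul_left ?_ _) (Dvd.dvd.mul_left ?_ _) <;>
        rw [Finsupp.single_apply] <;> split_ifs <;> simp
    · exact (X_pow_eq_monomial).symm
  · classical
    refine ⟨(invariantExponents d a b).image fun s => monomial s (1 : K), ?_, ?_, ?_⟩
    · intro F hF
      obtain ⟨s, hs, rfl⟩ := Finset.mem_image.1 hF
      exact isHomogeneous_monomial _ (mem_invariantExponents.1 hs).1
    · refine card_image_le.trans (hcard.trans ?_)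
      rw [show 2 - 1 = 1 from rfl, Nat.choose_one_right]
      omega
    · rw [coe_image]

end TogliattiSystem

/-! ### Divisibility by the conjugates of `x + y + z`, and minimality -/

section Minimality

open Finset MvPolynomial

variable {K : Type*} [Field K] {d a b : ℕ} {e : K}

theorem coeff_linearFactor (e : K) (a b n : ℕ) :
    coeff (Finsupp.single 0 1) (linearFactor e a b n) = 1 ∧
      coeff (Finsupp.single 1 1) (linearFactor e a b n) = e ^ (a * n) ∧
      coeff (Finsupp.single 2 1) (linearFactor e a b n) = e ^ (b * n) := by
  simp only [linearFactor, coeff_add, coeff_C_mul, coeff_X]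
  simp [Finsupp.single_left_inj]

theorem linearFactor_ne_zero (e : K) (a b n : ℕ) : linearFactor e a b n ≠ 0 := by
  intro h
  have := (coeff_linearFactor e a b n).1
  simp [h] at this

theorem isHomogeneous_linearFactor (e : K) (a b n : ℕ) :
    (linearFactor e a b n).IsHomogeneous 1 := by
  refine ((isHomogeneous_X K 0).add ?_).add ?_
  · simpa using (isHomogeneous_C (Fin 3) (e ^ (a * n))).mul (isHomogeneous_X K (1 : Fin 3))
  · simpa using (isHomogeneous_C (Fin 3) (e ^ (b * n))).mul (isHomogeneous_X K (2 : Fin 3))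

theorem irreducible_linearFactor (e : K) (a b n : ℕ) : Irreducible (linearFactor e a b n) := by
  refine irreducible_of_totalDegree_eq_one
    ((isHomogeneous_linearFactor e a b n).totalDegree (linearFactor_ne_zero e a b n)) fun x hx => ?_
  have := hx (Finsupp.single 0 1)
  rw [(coeff_linearFactor e a b n).1] at this
  exact isUnit_of_dvd_one this

theorem natCast_eq_of_pow_eq (hd : d ≠ 0) (he : IsPrimitiveRoot e d) {m n : ℕ}
    (h : e ^ m = e ^ n) : (m : ZMod d) = n := by
  wlog hmn : m ≤ n generalizing m n
  · exact (this h.symm (by omega)).symm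
  obtain ⟨r, rfl⟩ := Nat.exists_eq_add_of_le hmn
  rw [pow_add, eq_comm, mul_eq_left₀ (pow_ne_zero _ (he.ne_zero hd)),
    he.pow_eq_one_iff_dvd] at h
  simp [(ZMod.natCast_eq_zero_iff r d).2 h]

/-- A divisor of the same degree of a form is a multiple of it by a constant. -/
theorem exists_eq_C_mul_of_dvd {σ : Type*} {n : ℕ} {F G : MvPolynomial σ K}
    (hF : F.IsHomogeneous n) (hG : G.IsHomogeneous n) (hG0 : G ≠ 0) (h : F ∣ G) :
    ∃ c : K, c ≠ 0 ∧ G = C c * F := by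
  obtain ⟨q, rfl⟩ := h
  obtain ⟨hF0, hq0⟩ := mul_ne_zero_iff.1 hG0
  have h1 := hG.totalDegree hG0
  rw [totalDegree_mul_of_isDomain hF0 hq0, hF.totalDegree hF0] at h1
  have h2 := totalDegree_eq_zero_iff_eq_C.1 (show q.totalDegree = 0 by omega)
  refine ⟨coeff 0 q, fun h => hq0 (by rw [h2, h, C_0]), ?_⟩
  rw [← h2, mul_comm]

/-- The coefficient `1` of `x` makes proportional factors equal. Then `a (t - s)` and `b (t - s)`
vanish mod `d`, and the gcd condition gives `t = s`. -/
theorem not_linearFactor_dvd [NeZero d] (he : IsPrimitiveRoot e d)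
    (hgcd : Nat.gcd (Nat.gcd a b) d = 1) {t s : ZMod d} (hts : t ≠ s) :
    ¬ linearFactor e a b t.val ∣ linearFactor e a b s.val := by
  intro h
  obtain ⟨c, -, hc⟩ := exists_eq_C_mul_of_dvd (isHomogeneous_linearFactor e a b _)
    (isHomogeneous_linearFactor e a b _) (linearFactor_ne_zero e a b _) h
  obtain ⟨s0, s1, s2⟩ := coeff_linearFactor e a b s.val
  obtain ⟨t0, t1, t2⟩ := coeff_linearFactor e a b t.val
  rw [hc, coeff_C_mul] at s0 s1 s2
  rw [t0, mul_one] at s0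
  rw [t1, s0, one_mul] at s1
  rw [t2, s0, one_mul] at s2
  have h1 := natCast_eq_of_pow_eq (NeZero.ne d) he s1
  have h2 := natCast_eq_of_pow_eq (NeZero.ne d) he s2
  push_cast [ZMod.natCast_zmod_val] at h1 h2
  obtain ⟨u, v, huv⟩ := exists_natCast_combination hgcd
  exact hts (by linear_combination (s - t) * huv + u * h1 + v * h2)

theorem matrixAction_linearFactor (e : K) (a b n : ℕ) :
    matrixAction (n := 2) (diagMatrix e a b) (linearFactor e a b n) =
      linearFactor e a b (n + 1) := by
  simp only [linearFactor, map_add, map_mul, matrixAction_diagMatrix_X, ← algebraMap_eq,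
    AlgHom.commutes]
  simp only [algebraMap_eq, Matrix.cons_val_zero, Matrix.cons_val_one, Matrix.cons_val, C_1,
    one_mul, mul_add, pow_add, C_mul, mul_one]
  ring

/-- An invariant form of degree `d` divisible by `x + y + z` is a multiple of the norm of
`x + y + z`. -/
theorem exists_eq_C_mul_prod_linearFactor [NeZero d] (he : IsPrimitiveRoot e d)
    (hgcd : Nat.gcd (Nat.gcd a b) d = 1) {G : MvPolynomial (Fin 3) K} (hG0 : G ≠ 0)
    (hG : G.IsHomogeneous d) (hinv : matrixAction (n := 2) (diagMatrix e a b) G = G)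
    (hdvd : linearFactor e a b 0 ∣ G) :
    ∃ c : K, c ≠ 0 ∧ G = C c * ∏ t : ZMod d, linearFactor e a b t.val := by
  refine exists_eq_C_mul_of_dvd ?_ hG hG0 ?_
  · have := IsHomogeneous.prod univ (fun t : ZMod d => linearFactor e a b t.val) (fun _ => 1)
      fun t _ => isHomogeneous_linearFactor e a b _
    simpa using this
  · have hall (n : ℕ) : linearFactor e a b n ∣ G := by
      induction n with
      | zero => exact hdvd
      | succ n ih =>
        rw [← matrixAction_linearFactor, ← hinv]
        exact map_dvd _ ih
    refine Fintype.prod_dvd_of_isRelPrime (fun t s hts => ?_) fun t => hall _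
    exact (irreducible_linearFactor e a b _).isRelPrime_iff_not_dvd.2
      (not_linearFactor_dvd he hgcd hts)

/-- Only failure of injectivity for `x + y + z` is used: it puts a nonzero multiple of the norm into
the span of `T`, and the norm contains every invariant monomial. -/
theorem not_isTogliattiSystem_of_ssubset [CharZero K] (ha : 0 < a) (hab : a < b)
    (hb : b < d) (hgcd : Nat.gcd (Nat.gcd a b) d = 1) (he : IsPrimitiveRoot e d)
    {T : Set (Fin 3 →₀ ℕ)} (hT : T ⊂ (invariantExponents d a b : Set (Fin 3 →₀ ℕ))) :
    ¬ IsTogliattiSystem (n := 2) d (Ideal.span ((fun s => monomial s (1 : K)) '' T)) := by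
  have : NeZero d := ⟨by omega⟩
  intro h
  obtain ⟨hsub, s, hs, hsT⟩ := Set.ssubset_iff_exists.1 hT
  have hdeg : ∀ s ∈ T, s.degree = d :=
    fun s hs => (mem_invariantExponents.1 (mem_coe.1 (hsub hs))).1
  have hL := isHomogeneous_linearFactor e a b 0
  have hmax := h.failsWLP _ hL
  rw [HasMaximalRank, not_or] at hmax
  have hinj := hmax.1
  unfold Set.InjOn at hinj
  push Not at hinj
  obtain ⟨_, ⟨F₁, hF₁, rfl⟩, _, ⟨F₂, hF₂, rfl⟩, heq, hne⟩ := hinj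
  have hmem : linearFactor e a b 0 * (F₁ - F₂) ∈
      Ideal.span ((fun s => monomial s (1 : K)) '' T) := by
    rw [← Ideal.Quotient.eq_zero_iff_mem, map_mul, map_sub, mul_sub, sub_eq_zero]
    exact heq
  have hF : (linearFactor e a b 0 * (F₁ - F₂)).IsHomogeneous d := by
    have := hL.mul (IsHomogeneous.sub hF₁ hF₂)
    rwa [show 1 + (d - 1) = d by omega] at this
  have hF0 : linearFactor e a b 0 * (F₁ - F₂) ≠ 0 :=
    mul_ne_zero (linearFactor_ne_zero e a b 0) (sub_ne_zero.2 fun h => hne (by rw [h]))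
  have hsupp := (mem_span_monomial_iff_of_isHomogeneous hdeg hF).1 hmem
  have hinv := (matrixAction_diagMatrix_eq_self_iff (a := a) (b := b) he).2
    fun t ht => (mem_invariantExponents.1 (mem_coe.1 (hsub (hsupp t ht)))).2
  obtain ⟨c, hc, hG⟩ := exists_eq_C_mul_prod_linearFactor he hgcd hF0 hF hinv (dvd_mul_right _ _)
  refine hsT (hsupp s ?_)
  obtain ⟨hs1, hs2⟩ := mem_invariantExponents.1 (mem_coe.1 hs)
  have hcast {m n : ℕ} (hm : m < d) (hn : n < d) (h : m ≠ n) : (m : ZMod d) ≠ n := by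
    rw [Ne, ZMod.natCast_eq_natCast_iff]
    exact fun h' => h (Nat.ModEq.eq_of_lt_of_lt h' hm hn)
  rw [mem_support_iff, hG, coeff_C_mul]
  refine mul_ne_zero hc (coeff_prod_linearFactor_ne_zero he ?_ ?_ ?_ hgcd hs1 hs2)
  · simpa using hcast (m := a) (n := 0) (by omega) (by omega) (by omega)
  · simpa using hcast (m := b) (n := 0) (by omega) (by omega) (by omega)
  · exact hcast (by omega) (by omega) (by omega)

theorem isMinimalTogliattiSystem_invariant [CharZero K] (ha : 0 < a) (hab : a < b) (hb : b < d)
    (hgcd : Nat.gcd (Nat.gcd a b) d = 1) (he : IsPrimitiveRoot e d) :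
    IsMinimalTogliattiSystem (n := 2) d (Ideal.span ((fun s => monomial s (1 : K)) ''
      (invariantExponents d a b : Set (Fin 3 →₀ ℕ)))) := by
  refine ⟨isMonomialTogliattiSystem_invariant ha hab hb hgcd he, fun S hS hTog => ?_⟩
  have hdeg : ∀ s ∈ (invariantExponents d a b : Set (Fin 3 →₀ ℕ)), s.degree = d :=
    fun s hs => (mem_invariantExponents.1 (mem_coe.1 hs)).1
  have hgen : monomialGenerators (n := 2) d (Ideal.span ((fun s => monomial s (1 : K)) ''
      (invariantExponents d a b : Set (Fin 3 →₀ ℕ)))) =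
      (fun s => monomial s (1 : K)) '' (invariantExponents d a b : Set (Fin 3 →₀ ℕ)) := by
    ext m
    constructor
    · rintro ⟨hm, s, hs, rfl⟩
      refine ⟨s, ?_, rfl⟩
      exact (mem_span_monomial_iff_of_isHomogeneous hdeg (isHomogeneous_monomial 1 hs)).1 hm s
        (by simp [mem_support_iff])
    · rintro ⟨s, hs, rfl⟩
      exact ⟨Ideal.subset_span ⟨s, hs, rfl⟩, s, hdeg s hs, rfl⟩
  rw [hgen] at hS
  obtain ⟨T, hT, rfl⟩ := Set.subset_image_iff.1 hS.subset
  refine not_isTogliattiSystem_of_ssubset ha hab hb hgcd he (hT.ssubset_of_ne ?_)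
    hTog.toIsTogliattiSystem
  rintro rfl
  exact hS.ne rfl

end Minimality

/-! ### Cyclic Kummer extensions -/

section Kummer

open Polynomial IntermediateField

variable {E M : Type*} [Field E] [Field M] [Algebra E M] {d : ℕ} {ζ c : E} {w : M}

/-- If an automorphism multiplies `w` by a primitive `d`-th root of unity and `w ^ d = c`, then
`X ^ d - c` is irreducible. -/
theorem irreducible_X_pow_sub_C_of_algHom (hd : 0 < d) (hζ : IsPrimitiveRoot ζ d) (hw0 : w ≠ 0)
    (hw : w ^ d = algebraMap E M c) (σ : M →ₐ[E] M) (hσ : σ w = algebraMap E M ζ * w) :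
    Irreducible (X ^ d - C c : E[X]) := by
  have hζ' : IsPrimitiveRoot (algebraMap E M ζ) d :=
    hζ.map_of_injective (algebraMap E M).injective
  have hmonic : (X ^ d - C c : E[X]).Monic := monic_X_pow_sub_C c hd.ne'
  have haeval : aeval w (X ^ d - C c : E[X]) = 0 := by simp [hw]
  have hmin : X ^ d - C c = minpoly E w := by
    refine minpoly.unique E w hmonic haeval fun q hq hqw => ?_
    rw [degree_X_pow_sub_C hd, degree_eq_natDegree hq.ne_zero, Nat.cast_le]
    by_contra! hlt
    -- Iterating `σ` yields `d` distinct roots of `q`, too many for degree below `d`.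
    have hroot (i : ℕ) : aeval (algebraMap E M ζ ^ i * w) q = 0 := by
      induction i with
      | zero => simpa using hqw
      | succ i ih =>
        have := congrArg σ ih
        rw [← aeval_algHom_apply, map_zero, map_mul, map_pow, σ.commutes, hσ] at this
        rw [← this]
        ring_nf
    refine (hq.map (algebraMap E M)).ne_zero
      (eq_zero_of_natDegree_lt_card_of_eval_eq_zero (q.map (algebraMap E M))
        (f := fun i : Fin d => algebraMap E M ζ ^ (i : ℕ) * w) ?_ (fun i => ?_) ?_)
    · intro i j h
      exact Fin.ext (hζ'.pow_inj i.2 j.2 (mul_right_cancel₀ hw0 h))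
    · rw [eval_map_algebraMap]; exact hroot i
    · rw [natDegree_map, Fintype.card_fin]; exact hlt
  rw [hmin]
  exact minpoly.irreducible ⟨_, hmonic, haeval⟩

theorem isSplittingField_adjoin_root (hd : 0 < d) (hζ : IsPrimitiveRoot ζ d) (hw0 : w ≠ 0)
    (hw : w ^ d = algebraMap E M c) : IsSplittingField E E⟮w⟯ (X ^ d - C c) := by
  have hζ' : IsPrimitiveRoot (algebraMap E M ζ) d :=
    hζ.map_of_injective (algebraMap E M).injective
  rw [isSplittingField_iff]
  constructor
  · rw [Polynomial.map_sub, Polynomial.map_pow, map_X, map_C]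
    refine X_pow_sub_C_splits_of_isPrimitiveRoot
      (hζ.map_of_injective (algebraMap E E⟮w⟯).injective) (α := AdjoinSimple.gen E w) ?_
    exact Subtype.ext hw
  · have hmem (r : M) : r ∈ (X ^ d - C c : E[X]).rootSet M ↔ r ^ d = w ^ d := by
      rw [mem_rootSet, hw, map_sub, map_pow, aeval_X, aeval_C, sub_eq_zero]
      simp [(monic_X_pow_sub_C c hd.ne').ne_zero]
    apply le_antisymm
    · rw [adjoin_simple_le_iff]
      exact subset_adjoin _ _ ((hmem w).2 rfl)
    · rw [adjoin_le_iff]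
      intro r hr
      have : NeZero d := ⟨hd.ne'⟩
      have h1 : (r / w) ^ d = 1 := by
        rw [div_pow, (hmem r).1 hr, div_self (pow_ne_zero _ hw0)]
      obtain ⟨i, -, hi⟩ := hζ'.eq_pow_of_pow_eq_one h1
      rw [eq_div_iff hw0] at hi
      rw [← hi]
      exact mul_mem (pow_mem (IntermediateField.algebraMap_mem _ _) _) (mem_adjoin_simple_self E w)

theorem isGalois_adjoin_root_and_finrank_and_group (hd : 0 < d) (hζ : IsPrimitiveRoot ζ d)
    (hw0 : w ≠ 0) (hw : w ^ d = algebraMap E M c) (σ : M →ₐ[E] M)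
    (hσ : σ w = algebraMap E M ζ * w) :
    IsGalois E E⟮w⟯ ∧ Module.finrank E E⟮w⟯ = d ∧
      Nonempty ((E⟮w⟯ ≃ₐ[E] E⟮w⟯) ≃* Multiplicative (ZMod d)) := by
  have hirr := irreducible_X_pow_sub_C_of_algHom hd hζ hw0 hw σ hσ
  have := isSplittingField_adjoin_root hd hζ hw0 hw
  have hprim : (primitiveRoots d E).Nonempty := ⟨ζ, (mem_primitiveRoots hd).2 hζ⟩
  have : NeZero d := ⟨hd.ne'⟩
  exact ⟨isGalois_of_isSplittingField_X_pow_sub_C hprim hirr _,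
    finrank_of_isSplittingField_X_pow_sub_C hprim hirr _, ⟨autEquivZmod hirr _ hζ⟩⟩

end Kummer

/-! ### Function fields of the plane and of the image -/

section FunctionFields

open MvPolynomial IntermediateField

variable {K : Type*} [Field K] {d a b : ℕ} {e : K}

theorem algebraMap_comp_matrixAction_injective (he : e ≠ 0) (a b : ℕ) :
    Function.Injective ((IsScalarTower.toAlgHom K (MvPolynomial (Fin 3) K)
      (FractionRing (MvPolynomial (Fin 3) K))).comp (matrixAction (n := 2) (diagMatrix e a b))) :=
  (IsFractionRing.injective _ _).comp (matrixAction_diagMatrix_injective he a b)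

/-- The extension of `diag(1, e^a, e^b)` to the field of rational functions. -/
noncomputable def fractionAction (he : e ≠ 0) (a b : ℕ) :
    FractionRing (MvPolynomial (Fin 3) K) →ₐ[K] FractionRing (MvPolynomial (Fin 3) K) :=
  IsFractionRing.liftAlgHom (algebraMap_comp_matrixAction_injective he a b)

theorem fractionAction_algebraMap (he : e ≠ 0) (F : MvPolynomial (Fin 3) K) :
    fractionAction he a b (algebraMap _ _ F) =
      algebraMap _ _ (matrixAction (n := 2) (diagMatrix e a b) F) :=
  IsFractionRing.lift_algebraMap (algebraMap_comp_matrixAction_injective he a b) F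

/-- The rational function `x_i / x_0`. -/
noncomputable def affineCoord (K : Type*) [Field K] (i : Fin 3) :
    FractionRing (MvPolynomial (Fin 3) K) :=
  algebraMap _ _ (X i : MvPolynomial (Fin 3) K) / algebraMap _ _ (X 0 : MvPolynomial (Fin 3) K)

theorem algebraMap_X_ne_zero (i : Fin 3) : algebraMap (MvPolynomial (Fin 3) K)
    (FractionRing (MvPolynomial (Fin 3) K)) (X i) ≠ 0 := by
  rw [Ne, FaithfulSMul.algebraMap_eq_zero_iff]
  exact X_ne_zero i

theorem affineCoord_ne_zero (i : Fin 3) : affineCoord K i ≠ 0 :=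
  div_ne_zero (algebraMap_X_ne_zero i) (algebraMap_X_ne_zero 0)

theorem fractionAction_affineCoord (he : e ≠ 0) :
    fractionAction he a b (affineCoord K 1) = algebraMap K _ e ^ a * affineCoord K 1 ∧
      fractionAction he a b (affineCoord K 2) = algebraMap K _ e ^ b * affineCoord K 2 := by
  have h (c : K) : algebraMap (MvPolynomial (Fin 3) K) (FractionRing (MvPolynomial (Fin 3) K))
      (C c) = algebraMap K _ c := by
    rw [← MvPolynomial.algebraMap_eq, ← IsScalarTower.algebraMap_apply]
  constructor <;>
  · rw [affineCoord, map_div₀, fractionAction_algebraMap, fractionAction_algebraMap,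
      matrixAction_diagMatrix_X, matrixAction_diagMatrix_X, map_mul, map_mul, h, h]
    simp [mul_div_assoc]

theorem algebraMap_monomial_div {s : Fin 3 →₀ ℕ} {n : ℕ} (hs : s.degree = n) (c : K) :
    algebraMap (MvPolynomial (Fin 3) K) (FractionRing (MvPolynomial (Fin 3) K)) (monomial s c) /
      algebraMap _ _ (X 0 : MvPolynomial (Fin 3) K) ^ n =
      algebraMap K _ c * (affineCoord K 1 ^ s 1 * affineCoord K 2 ^ s 2) := by
  rw [monomial_eq, Finsupp.prod_fintype _ _ (by simp), Fin.prod_univ_three, ← hs,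
    Finsupp.degree_eq_sum, Fin.sum_univ_three, ← MvPolynomial.algebraMap_eq, affineCoord,
    affineCoord]
  have := algebraMap_X_ne_zero (K := K) 0
  simp only [map_mul, map_pow, ← IsScalarTower.algebraMap_apply, div_pow, pow_add]
  field_simp

theorem affine_monomial_mem_imageFunctionField_of_le {j k : ℕ} (hjk : j + k ≤ d)
    (h : d ∣ a * j + b * k) :
    affineCoord K 1 ^ j * affineCoord K 2 ^ k ∈ imageFunctionField (n := 2) d
      (Ideal.span ((fun s => monomial s (1 : K)) ''
        (invariantExponents d a b : Set (Fin 3 →₀ ℕ)))) := by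
  refine subset_adjoin _ _ ?_
  let s : Fin 3 →₀ ℕ := Finsupp.equivFunOnFinite.symm ![d - j - k, j, k]
  let t : Fin 3 →₀ ℕ := Finsupp.single 0 d
  have hs0 : s 0 = d - j - k := rfl
  have hs1 : s 1 = j := rfl
  have hs2 : s 2 = k := rfl
  have hs : s.degree = d := by
    rw [Finsupp.degree_eq_sum, Fin.sum_univ_three, hs0, hs1, hs2]; omega
  have ht : t.degree = d := by simp [t]
  refine ⟨monomial s 1, monomial t 1, Ideal.subset_span ⟨s, ?_, rfl⟩,
    Ideal.subset_span ⟨t, ?_, rfl⟩, isHomogeneous_monomial _ hs, isHomogeneous_monomial _ ht,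
    by simp, ?_⟩
  · exact Finset.mem_coe.2 (mem_invariantExponents.2 ⟨hs, by rwa [hs1, hs2]⟩)
  · exact Finset.mem_coe.2 (mem_invariantExponents.2 ⟨ht, by simp [t]⟩)
  · have h1 : monomial t (1 : K) = X 0 ^ d := X_pow_eq_monomial.symm
    have h2 := algebraMap_monomial_div hs (1 : K)
    rw [h1, map_pow, h2, hs1, hs2, map_one, one_mul]

theorem affine_monomial_mem_imageFunctionField (hd : 0 < d) {j k : ℕ} (h : d ∣ a * j + b * k) :
    affineCoord K 1 ^ j * affineCoord K 2 ^ k ∈ imageFunctionField (n := 2) d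
      (Ideal.span ((fun s => monomial s (1 : K)) ''
        (invariantExponents d a b : Set (Fin 3 →₀ ℕ)))) := by
  set E := imageFunctionField (n := 2) d (Ideal.span ((fun s => monomial s (1 : K)) ''
        (invariantExponents d a b : Set (Fin 3 →₀ ℕ))))
  have hy : affineCoord K 1 ^ d ∈ E := by
    have := affine_monomial_mem_imageFunctionField_of_le (K := K) (d := d) (a := a) (b := b)
      (j := d) (k := 0) (by omega) (by simp)
    simpa using this
  have hz : affineCoord K 2 ^ d ∈ E := by
    have := affine_monomial_mem_imageFunctionField_of_le (K := K) (d := d) (a := a) (b := b)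
      (j := 0) (k := d) (by omega) (by simp)
    simpa using this
  have hj := Nat.mod_add_div j d
  have hk := Nat.mod_add_div k d
  have hj' := Nat.mod_lt j hd
  have hk' := Nat.mod_lt k hd
  generalize j % d = j₀ at *
  generalize k % d = k₀ at *
  generalize j / d = m at *
  generalize k / d = n at *
  subst hj hk
  have h0 : d ∣ a * j₀ + b * k₀ := by
    refine (Nat.dvd_add_left
      (show d ∣ a * (d * m) + b * (d * n) from ⟨a * m + b * n, by ring⟩)).1 ?_
    convert h using 1; ring
  rw [pow_add, pow_add, pow_mul, pow_mul, mul_mul_mul_comm]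
  refine mul_mem ?_ (mul_mem (pow_mem hy _) (pow_mem hz _))
  by_cases hle : j₀ + k₀ ≤ d
  · exact affine_monomial_mem_imageFunctionField_of_le hle h0
  -- When `j₀ + k₀ > d` the complementary exponents have sum below `d` and are again invariant, so
  -- the monomial is `y^d z^d` over the complementary one.
  · have hc : affineCoord K 1 ^ (d - j₀) * affineCoord K 2 ^ (d - k₀) ∈ E := by
      refine affine_monomial_mem_imageFunctionField_of_le (by omega) ?_
      refine (Nat.dvd_add_left h0).1 ⟨a + b, ?_⟩
      zify [hj'.le, hk'.le]
      ring
    have heq : affineCoord K 1 ^ j₀ * affineCoord K 2 ^ k₀ =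
        affineCoord K 1 ^ d * affineCoord K 2 ^ d *
          (affineCoord K 1 ^ (d - j₀) * affineCoord K 2 ^ (d - k₀))⁻¹ := by
      rw [eq_mul_inv_iff_mul_eq₀ (mul_ne_zero (pow_ne_zero _ (affineCoord_ne_zero 1))
        (pow_ne_zero _ (affineCoord_ne_zero 2))), mul_mul_mul_comm, ← pow_add, ← pow_add,
        Nat.add_sub_cancel' hj'.le, Nat.add_sub_cancel' hk'.le]
    rw [heq]
    exact mul_mem (mul_mem hy hz) (inv_mem hc)

theorem fractionAction_eq_self_of_mem (he : IsPrimitiveRoot e d) (he0 : e ≠ 0)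
    {q : FractionRing (MvPolynomial (Fin 3) K)} (hq : q ∈ imageFunctionField (n := 2) d
      (Ideal.span ((fun s => monomial s (1 : K)) ''
        (invariantExponents d a b : Set (Fin 3 →₀ ℕ))))) :
    fractionAction he0 a b q = q := by
  unfold imageFunctionField at hq
  induction hq using adjoin_induction with
  | mem x hx =>
    obtain ⟨F, G, hF, hG, hF', hG', -, rfl⟩ := hx
    rw [map_div₀]
    erw [fractionAction_algebraMap, fractionAction_algebraMap]
    rw [(mem_span_invariantExponents_iff he hF').1 hF,
      (mem_span_invariantExponents_iff he hG').1 hG]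
  | algebraMap c => exact AlgHom.commutes _ c
  | add x y _ _ hx hy => rw [map_add, hx, hy]
  | inv x _ hx => rw [map_inv₀, hx]
  | mul x y _ _ hx hy => rw [map_mul, hx, hy]

theorem affineCoord_mem_projectiveFunctionField (i : Fin 3) :
    affineCoord K i ∈ projectiveFunctionField K 2 :=
  subset_adjoin _ _ ⟨1, X i, X 0, isHomogeneous_X _ _, isHomogeneous_X _ _, X_ne_zero _, rfl⟩

/-- The function field of `ℙ²` is generated by the affine coordinates. -/
theorem projectiveFunctionField_le {E : IntermediateField K (FractionRing (MvPolynomial (Fin 3) K))}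
    (h1 : affineCoord K 1 ∈ E) (h2 : affineCoord K 2 ∈ E) : projectiveFunctionField K 2 ≤ E := by
  have key {n : ℕ} {F : MvPolynomial (Fin 3) K} (hF : F.IsHomogeneous n) :
      algebraMap _ (FractionRing (MvPolynomial (Fin 3) K)) F /
        algebraMap _ _ (X 0 : MvPolynomial (Fin 3) K) ^ n ∈ E := by
    rw [F.as_sum, map_sum, Finset.sum_div]
    refine sum_mem fun s hs => ?_
    rw [algebraMap_monomial_div (isHomogeneous_iff_degree.1 hF s hs)]
    exact mul_mem (IntermediateField.algebraMap_mem _ _) (mul_mem (pow_mem h1 _) (pow_mem h2 _))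
  refine adjoin_le_iff.2 ?_
  rintro _ ⟨n, F, G, hF, hG, -, rfl⟩
  have := div_mem (key hF) (key hG)
  rwa [div_div_div_cancel_right₀ (pow_ne_zero _ (algebraMap_X_ne_zero 0))] at this

theorem isCyclicGaloisCovering_invariant (hd : 0 < d) (hgcd : Nat.gcd (Nat.gcd a b) d = 1)
    (he : IsPrimitiveRoot e d) :
    IsCyclicGaloisCovering (n := 2) d (Ideal.span ((fun s => monomial s (1 : K)) ''
      (invariantExponents d a b : Set (Fin 3 →₀ ℕ)))) := by
  have : NeZero d := ⟨hd.ne'⟩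
  set I : Ideal (MvPolynomial (Fin 3) K) := Ideal.span ((fun s => monomial s (1 : K)) ''
      (invariantExponents d a b : Set (Fin 3 →₀ ℕ)))
  have he0 : e ≠ 0 := he.ne_zero hd.ne'
  obtain ⟨p, q, hpq⟩ := exists_natCast_combination hgcd
  set y := affineCoord K 1
  set z := affineCoord K 2
  -- A monomial of weight `a p + b q ≡ 1`: the action multiplies it by `e` itself.
  set w := y ^ p * z ^ q with hw
  have hw0 : w ≠ 0 := mul_ne_zero (pow_ne_zero _ (affineCoord_ne_zero 1))
    (pow_ne_zero _ (affineCoord_ne_zero 2))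
  have hwd : w ^ d ∈ imageFunctionField (n := 2) d I := by
    rw [hw, mul_pow, ← pow_mul, ← pow_mul]
    exact affine_monomial_mem_imageFunctionField hd ⟨a * p + b * q, by ring⟩
  -- The factor `d - 1` stands for `-1` mod `d`: it cancels the weight `a` of `y` with a natural
  -- exponent, so `y` lies in the field generated by `w`.
  have hy : y * w ^ (a * (d - 1)) ∈ imageFunctionField (n := 2) d I := by
    have : y * w ^ (a * (d - 1)) = y ^ (1 + p * (a * (d - 1))) * z ^ (q * (a * (d - 1))) := by
      rw [hw]; ring
    rw [this]
    refine affine_monomial_mem_imageFunctionField hd ?_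
    rw [← ZMod.natCast_eq_zero_iff]
    push_cast [Nat.cast_sub hd]
    rw [ZMod.natCast_self]
    linear_combination (-a : ZMod d) * hpq
  have hz : z * w ^ (b * (d - 1)) ∈ imageFunctionField (n := 2) d I := by
    have : z * w ^ (b * (d - 1)) = y ^ (p * (b * (d - 1))) * z ^ (1 + q * (b * (d - 1))) := by
      rw [hw]; ring
    rw [this]
    refine affine_monomial_mem_imageFunctionField hd ?_
    rw [← ZMod.natCast_eq_zero_iff]
    push_cast [Nat.cast_sub hd]
    rw [ZMod.natCast_self]
    linear_combination (-b : ZMod d) * hpq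
  have hcov : coveringExtension (n := 2) d I = (imageFunctionField (n := 2) d I)⟮w⟯ := by
    apply le_antisymm
    · have hwmem := mem_adjoin_simple_self (imageFunctionField (n := 2) d I) w
      have hmem {t : FractionRing (MvPolynomial (Fin 3) K)} {n : ℕ}
          (ht : t * w ^ n ∈ imageFunctionField (n := 2) d I) :
          t ∈ (imageFunctionField (n := 2) d I)⟮w⟯ := by
        have h1 : t * w ^ n ∈ (imageFunctionField (n := 2) d I)⟮w⟯ :=
          IntermediateField.algebraMap_mem _ (⟨_, ht⟩ : imageFunctionField (n := 2) d I)
        have h2 := div_mem h1 (pow_mem hwmem n)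
        rwa [mul_div_cancel_right₀ _ (pow_ne_zero n hw0)] at h2
      exact projectiveFunctionField_le
        (E := ((imageFunctionField (n := 2) d I)⟮w⟯).restrictScalars K) (hmem hy) (hmem hz)
    · rw [adjoin_simple_le_iff]
      exact mul_mem (pow_mem (affineCoord_mem_projectiveFunctionField 1) _)
        (pow_mem (affineCoord_mem_projectiveFunctionField 2) _)
  let σ : FractionRing (MvPolynomial (Fin 3) K) →ₐ[imageFunctionField (n := 2) d I]
      FractionRing (MvPolynomial (Fin 3) K) :=
    { (fractionAction he0 a b : _ →+* _) with
      commutes' := fun c => fractionAction_eq_self_of_mem he he0 c.2 }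
  let ζ : imageFunctionField (n := 2) d I := algebraMap K _ e
  have hζ : IsPrimitiveRoot ζ d := he.map_of_injective (algebraMap K _).injective
  have hσ : σ w = algebraMap _ _ ζ * w := by
    have hepow : e ^ (a * p + b * q) = e := by
      have h : a * p + b * q ≡ 1 [MOD d] := by
        rw [← ZMod.natCast_eq_natCast_iff]
        push_cast
        linear_combination hpq
      simpa using pow_eq_pow_of_modEq h he.pow_eq_one
    show fractionAction he0 a b w = algebraMap K _ e * w
    obtain ⟨h1, h2⟩ := fractionAction_affineCoord (K := K) (a := a) (b := b) he0
    rw [hw, map_mul, map_pow, map_pow, h1, h2]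
    nth_rewrite 3 [← hepow]
    rw [map_pow]
    ring
  obtain ⟨g1, g2, g3⟩ := isGalois_adjoin_root_and_finrank_and_group hd hζ hw0
    (c := ⟨w ^ d, hwd⟩) rfl σ hσ
  constructor
  · rw [hcov]; exact g1
  · rw [hcov]; exact g2
  · rw [hcov]; exact g3

end FunctionFields

end Togliatti

theorem theorem3p6 {K : Type*} [Field K] [IsAlgClosed K] [CharZero K]
    (d a b : ℕ) (hd : 3 ≤ d) (ha : 1 ≤ a) (hab : a < b) (hb : b ≤ d - 1)
    (hgcd : Nat.gcd (Nat.gcd a b) d = 1) (e : K) (he : IsPrimitiveRoot e d) :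
    Togliatti.IsGTSystem d
        (Togliatti.invariantMonomialIdeal (n := 2) d (Togliatti.diagMatrix e a b)) ∧
      Togliatti.IsMinimalTogliattiSystem d
        (Togliatti.invariantMonomialIdeal (n := 2) d (Togliatti.diagMatrix e a b)) := by
  have hb' : b < d := by omega
  rw [Togliatti.invariantMonomialIdeal_diagMatrix he]
  have hmin := Togliatti.isMinimalTogliattiSystem_invariant ha hab hb' hgcd he
  exact ⟨⟨hmin.toIsTogliattiSystem,
    Togliatti.isCyclicGaloisCovering_invariant (by omega) hgcd he⟩, hmin⟩
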